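/- Let $A$ be an entrywise non-negative real $d\times d$ matrix with spectral radius $\rho(A)>1$, and let $\|\cdot\|$ be the Frobenius norm. Consider the problem $$\|X-A\|\to\min,\qquad \rho(X)\le 1,\quad X\ge 0 \text{ (entrywise)}. \qquad (1)$$ An admissible initial matrix is a matrix $X_0\ge 0$ with $\rho(X_0)=1$ whose support (set of positions of positive entries) contains the support of $A$. Starting from such an $X_0$, the Algorithm produces matrices $X_0,X_1,X_2,\dots$ as follows. - If $k$ is even, take a right leading eigenvector $v_k>0$ of $X_k$, that is, $X_kv_k=\rho(X_k)v_k$, and let $X_{k+1}$ be the solution of $\|X-A\|\to\min$, $Xv_k\le v_k$, $X\ge 0$. - If $k$ is odd, take a left leading eigenvector $u_k>0$ of $X_k$, that is, $u_k^TX_k=\rho(X_k)u_k^T$, and let $X_{k+1}$ be the solution of $\|X-A\|\to\min$, $u_k^TX\le u_k^T$, $X\ge 0$. If at some step no strictly positive leading eigenvector exists, the iteration breaks off. The Algorithm started at $X_0$ is said to converge to $X$ if it produces (for some choice of the leading eigenvectors, if they are not unique up to scaling) an infinite sequence with $\|X_k-X\|\to 0$. The convergence is called stable if there are $\varepsilon>0$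 and $N\in\mathbb N$ such that for every $k>N$ and every admissible initial matrix $\tilde X_k$ with $\|\tilde X_k-X_k\|<\varepsilon$, the Algorithm started at $\tilde X_k$ converges to the same matrix $X$. **Theorem.** Suppose the Algorithm, started at some admissible $X_0$, converges stably to a strictly positive matrix $X$. Then $X$ is a global minimum of problem (1). Moreover, $X$ is the following explicit matrix. Let $M=(I-A^T)(I-A)$ and let $\mu$ be the smallest eigenvalue of $M$; then $\mu>0$, and there is an eigenvector $v\ge 0$ of $M$ with eigenvalue $\mu$ and $\|v\|=1$ such that, with $r=-\sqrt\mu$ and $u=\frac1r(I-A)v$, one has $u\ge 0$ and $X=A+r\,uv^T\ge 0$. Finally, if $d\ge 2$, then there is a constant $C$ such that $$\|X_n-X\|\le C\left(\frac{\sigma_1}{\sigma_2}\right)^n\qquad\text{for all } n\ge 0,$$ where $\sigma_1\le\sigma_2$ are the smallest and the second smallest singular values of $I-A$, counted with multiplicity. -/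

import Mathlib

open Filter Topology

attribute [local instance] Matrix.frobeniusNormedAddCommGroup

namespace ClosestStable

noncomputable section

/-- The spectral radius `ρ(X)`: the maximum modulus of the complex eigenvalues of `X`. -/
def rho {d : ℕ} (X : Matrix (Fin d) (Fin d) ℝ) : ℝ :=
  (spectralRadius ℂ (X.map (fun x : ℝ => (x : ℂ)))).toReal

/-- Entrywise non-negativity `X ≥ 0`. -/
def Nonneg {d : ℕ} (X : Matrix (Fin d) (Fin d) ℝ) : Prop :=
  ∀ i j, 0 ≤ X i j

/-- `X` is a global minimum of the problem `‖X - A‖ → min`, `ρ(X) ≤ 1`, `X ≥ 0`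
(the norm on matrices is the Frobenius norm throughout). -/
def IsClosestStable {d : ℕ} (A X : Matrix (Fin d) (Fin d) ℝ) : Prop :=
  Nonneg X ∧ rho X ≤ 1 ∧
    ∀ Y : Matrix (Fin d) (Fin d) ℝ, Nonneg Y → rho Y ≤ 1 → ‖X - A‖ ≤ ‖Y - A‖

/-- `Y` solves the problem `‖Y - A‖ → min`, `Y v ≤ v`, `Y ≥ 0`. -/
def SolvesRight {d : ℕ} (A : Matrix (Fin d) (Fin d) ℝ) (v : Fin d → ℝ)
    (Y : Matrix (Fin d) (Fin d) ℝ) : Prop :=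
  (Nonneg Y ∧ ∀ i, Y.mulVec v i ≤ v i) ∧
    ∀ Z : Matrix (Fin d) (Fin d) ℝ, Nonneg Z → (∀ i, Z.mulVec v i ≤ v i) →
      ‖Y - A‖ ≤ ‖Z - A‖

/-- `Y` solves the problem `‖Y - A‖ → min`, `uᵀ Y ≤ uᵀ`, `Y ≥ 0`. -/
def SolvesLeft {d : ℕ} (A : Matrix (Fin d) (Fin d) ℝ) (u : Fin d → ℝ)
    (Y : Matrix (Fin d) (Fin d) ℝ) : Prop :=
  (Nonneg Y ∧ ∀ j, Matrix.vecMul u Y j ≤ u j) ∧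
    ∀ Z : Matrix (Fin d) (Fin d) ℝ, Nonneg Z → (∀ j, Matrix.vecMul u Z j ≤ u j) →
      ‖Y - A‖ ≤ ‖Z - A‖

/-- The step of the algorithm that uses a (strictly positive) right leading eigenvector `v`
of the current matrix `X`; `Y` is the next matrix. -/
def RightStep {d : ℕ} (A X Y : Matrix (Fin d) (Fin d) ℝ) : Prop :=
  ∃ v : Fin d → ℝ, (∀ i, 0 < v i) ∧ X.mulVec v = rho X • v ∧ SolvesRight A v Y

/-- The step of the algorithm that uses a (strictly positive) left leading eigenvector `u`
of the current matrix `X`; `Y` is the next matrix. -/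
def LeftStep {d : ℕ} (A X Y : Matrix (Fin d) (Fin d) ℝ) : Prop :=
  ∃ u : Fin d → ℝ, (∀ i, 0 < u i) ∧ Matrix.vecMul u X = rho X • u ∧ SolvesLeft A u Y

/-- Admissible initial matrices: `X₀ ≥ 0`, normalized by `ρ(X₀) = 1`, with a support that is
not smaller than the support of `A`. -/
def IsStart {d : ℕ} (A X₀ : Matrix (Fin d) (Fin d) ℝ) : Prop :=
  Nonneg X₀ ∧ rho X₀ = 1 ∧ ∀ i j, 0 < A i j → 0 < X₀ i j

/-- `X 0, X 1, X 2, …` is a run of the algorithm for `A`: right and left leading eigenvectors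
alternate, the first step using the right one. -/
def IsRun {d : ℕ} (A : Matrix (Fin d) (Fin d) ℝ) (X : ℕ → Matrix (Fin d) (Fin d) ℝ) : Prop :=
  IsStart A (X 0) ∧
    ∀ k, (Even k → RightStep A (X k) (X (k + 1))) ∧ (Odd k → LeftStep A (X k) (X (k + 1)))

/-- The sequence of matrices `X k` converges to `L`. -/
def ConvergesTo {d : ℕ} (X : ℕ → Matrix (Fin d) (Fin d) ℝ)
    (L : Matrix (Fin d) (Fin d) ℝ) : Prop :=
  Tendsto (fun k => ‖X k - L‖) atTop (𝓝 0)

/-- The algorithm started at `Y` converges to `L`. -/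
def AlgorithmConverges {d : ℕ} (A Y L : Matrix (Fin d) (Fin d) ℝ) : Prop :=
  ∃ X : ℕ → Matrix (Fin d) (Fin d) ℝ, IsRun A X ∧ X 0 = Y ∧ ConvergesTo X L

/-- The run `X` of the algorithm for `A` converges stably to `L`: it converges to `L`, and for
some `ε > 0` and `N`, the algorithm restarted at any admissible matrix in the `ε`-neighbourhood
of some `X k`, `k > N`, converges to the same `L`. -/
def StablyConverges {d : ℕ} (A : Matrix (Fin d) (Fin d) ℝ)
    (X : ℕ → Matrix (Fin d) (Fin d) ℝ) (L : Matrix (Fin d) (Fin d) ℝ) : Prop :=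
  IsRun A X ∧ ConvergesTo X L ∧
    ∃ ε : ℝ, 0 < ε ∧ ∃ N : ℕ, ∀ k, N < k →
      ∀ Y : Matrix (Fin d) (Fin d) ℝ, IsStart A Y → ‖Y - X k‖ < ε → AlgorithmConverges A Y L

/-- The matrix `M = (I - Aᵀ)(I - A)`. -/
def matM {d : ℕ} (A : Matrix (Fin d) (Fin d) ℝ) : Matrix (Fin d) (Fin d) ℝ :=
  (1 - A.transpose) * (1 - A)

/-- `X = A + r u vᵀ` where `v ≥ 0` is a unit eigenvector of `M` for its smallest eigenvalue
`μ > 0`, `r = -√μ`, `u = r⁻¹ (I - A) v`, and both `u` and `X` are non-negative. -/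
def IsExplicitMatrix {d : ℕ} (A X : Matrix (Fin d) (Fin d) ℝ) : Prop :=
  ∃ (μ r : ℝ) (v u : Fin d → ℝ),
    IsLeast {t : ℝ | Module.End.HasEigenvalue (Matrix.toLin' (matM A)) t} μ ∧ 0 < μ ∧
    (matM A).mulVec v = μ • v ∧ dotProduct v v = 1 ∧ (∀ i, 0 ≤ v i) ∧
    r = -Real.sqrt μ ∧ u = r⁻¹ • (1 - A).mulVec v ∧ (∀ i, 0 ≤ u i) ∧
    X = A + r • Matrix.vecMulVec u v ∧ Nonneg X

/-- The `i`-th smallest singular value of `I - A`, counted with multiplicity, for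
`1 ≤ i ≤ d`. (Mathlib lists singular values in decreasing order, starting from index `0`.) -/
def sigma {d : ℕ} (A : Matrix (Fin d) (Fin d) ℝ) (i : ℕ) : ℝ :=
  (Matrix.toEuclideanLin (1 - A)).singularValues (d - i)

end

end ClosestStable

/-!
Write `B = A - 1`. The proof shows that near its limit the algorithm is the inverse power iteration
for `Bᵀ B`, and that the distance to `A` is a Lyapunov function which excludes every singular vector
except the leading one of that iteration.

*Form of the limit.* If a step with the right eigenvector `v` produces a positive matrix `Y`, the
optimality conditions (`SolvesRight.exists_multiplier`) give `A - Y = t vᵀ` with `t ≥ 0`, and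
`(Y v) i = v i` wherever `t i ≠ 0`. Left steps are right steps for the transposed matrices. In the
limit (`exists_limit_multiplier`) the even steps give `A - L = t vᵀ` and the odd ones `A - L = u sᵀ`,
so that `L = A - c u vᵀ` with `L v = v` and `Lᵀ u = u`. Hence `B v = c u` and `Bᵀ u = c v`
(`exists_isSingularPair`).

*Stability selects the smallest singular value.* The current matrix is feasible for the next
minimization, so `‖X k - A‖` never increases, and no run that starts closer to `A` than `L` can
converge to `L`. The matrix `closestFixing A w = A - B w wᵀ / (w · w)` fixes `w`, equals `L` at
`w = v`, and lies at distance `|B w| / |w|` from `A`. If `|B x| < c |x|` for some `x`, then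
`w = v + ε x` produces admissible matrices near `L` that are strictly closer to `A`, contradicting
stability (`IsSingularPair.le_rayleigh`).

*Global minimality.* If `Y ≥ 0`, `ρ(Y) ≤ 1` and `‖Y - A‖ < c`, then `1 - Z` is invertible for every
`Z` on the segments from `0` to `Y` and from `Y` to `A`. Along such segments the vector
`(1 - Z)⁻¹ 1` stays non-negative, so `x = (1 - A)⁻¹ 1` is positive with `A x ≤ x`, which forces
`ρ(A) ≤ 1` (`le_norm_sub_of_rho_le_one`). No Perron–Frobenius theorem is needed.

*Rate.* Since `0 < L < A`, all constraints are eventually active and `X (n + 1)` is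
`closestFixing A w` (or its transposed analogue) for the current eigenvector `w`. The next
eigenvector `w'` then satisfies `Bᵀ w' = c w` after normalization, and `B`, `Bᵀ` expand by at least
`σ₂` on the complements of `v` and `u`, so the component of the eigenvector orthogonal to the limit
contracts by `σ₁ / σ₂` in every step (`FixesNear.step`). That component controls `‖X n - L‖`.
-/

namespace ClosestStable

open Matrix

variable {d : ℕ}

/-! ### Frobenius norm and spectral radius -/

theorem frobenius_norm_sq (X : Matrix (Fin d) (Fin d) ℝ) : ‖X‖ ^ 2 = ∑ i, ∑ j, X i j ^ 2 := by
  rw [Matrix.frobenius_norm_def, ← Real.rpow_natCast, ← Real.rpow_mul]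
  · norm_num
  · exact Finset.sum_nonneg fun i _ => Finset.sum_nonneg fun j _ => by positivity

theorem abs_apply_le_norm (X : Matrix (Fin d) (Fin d) ℝ) (i j : Fin d) : |X i j| ≤ ‖X‖ := by
  refine abs_le_of_sq_le_sq ?_ (norm_nonneg _)
  rw [frobenius_norm_sq]
  calc X i j ^ 2 ≤ ∑ j, X i j ^ 2 :=
        Finset.single_le_sum (f := fun j => X i j ^ 2) (fun _ _ => sq_nonneg _) (Finset.mem_univ j)
    _ ≤ _ := Finset.single_le_sum (f := fun i => ∑ j, X i j ^ 2)
        (fun _ _ => Finset.sum_nonneg fun _ _ => sq_nonneg _) (Finset.mem_univ i)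

theorem frobenius_norm_sq_vecMulVec (u v : Fin d → ℝ) :
    ‖vecMulVec u v‖ ^ 2 = (u ⬝ᵥ u) * (v ⬝ᵥ v) := by
  rw [frobenius_norm_sq]
  simp only [vecMulVec_apply, dotProduct, Finset.sum_mul_sum]
  exact Finset.sum_congr rfl fun i _ => Finset.sum_congr rfl fun j _ => by ring

theorem mulVec_dotProduct_self_le (X : Matrix (Fin d) (Fin d) ℝ) (x : Fin d → ℝ) :
    (X *ᵥ x) ⬝ᵥ (X *ᵥ x) ≤ ‖X‖ ^ 2 * (x ⬝ᵥ x) := by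
  rw [frobenius_norm_sq, Finset.sum_mul]
  refine Finset.sum_le_sum fun i _ => ?_
  have := Finset.sum_mul_sq_le_sq_mul_sq Finset.univ (fun j => X i j) x
  simp only [mulVec, dotProduct] at *
  simp only [← sq] at *
  exact this

theorem dotProduct_self_pos_of_ne_zero {x : Fin d → ℝ} (hx : x ≠ 0) : 0 < x ⬝ᵥ x := by
  simpa using (dotProduct_star_self_pos_iff (v := x)).2 hx

theorem dotProduct_self_nonneg' (x : Fin d → ℝ) : 0 ≤ x ⬝ᵥ x :=
  Finset.sum_nonneg fun i _ => mul_self_nonneg (x i)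

theorem mem_spectrum_iff_exists_mulVec_eq {K : Type*} [Field K] (X : Matrix (Fin d) (Fin d) K)
    (t : K) : t ∈ spectrum K X ↔ ∃ z, z ≠ 0 ∧ X *ᵥ z = t • z := by
  rw [← Matrix.spectrum_toLin', ← Module.End.hasEigenvalue_iff_mem_spectrum]
  constructor
  · intro h
    obtain ⟨z, hz⟩ := h.exists_hasEigenvector
    exact ⟨z, hz.2, by simpa using hz.apply_eq_smul⟩
  · rintro ⟨z, hz, h⟩
    exact Module.End.hasEigenvalue_of_hasEigenvector (x := z)
      ⟨Module.End.mem_eigenspace_iff.2 (by simpa using h), hz⟩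

/-- A positive vector `v` with `X v ≤ s v` bounds the spectral radius of `X ≥ 0` by `s`: at a
position where `|z i| / v i` is largest, the eigenvalue equation for `z` gives `|λ| ≤ s`. -/
theorem rho_le_of_mulVec_le {X : Matrix (Fin d) (Fin d) ℝ} (hX : Nonneg X) {v : Fin d → ℝ}
    (hv : ∀ i, 0 < v i) {s : ℝ} (hs : 0 ≤ s) (h : ∀ i, (X *ᵥ v) i ≤ s * v i) : rho X ≤ s := by
  refine ENNReal.toReal_le_of_le_ofReal hs (iSup₂_le fun t ht => ?_)
  rw [mem_spectrum_iff_exists_mulVec_eq] at ht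
  obtain ⟨z, hz, hzt⟩ := ht
  have hne : Nonempty (Fin d) := by
    by_contra hc
    rw [not_nonempty_iff] at hc
    exact hz (Subsingleton.elim _ _)
  obtain ⟨i, -, hi⟩ := Finset.exists_max_image Finset.univ (fun i => ‖z i‖ / v i)
    Finset.univ_nonempty
  have hle : ∀ j, ‖z j‖ ≤ ‖z i‖ / v i * v j := fun j =>
    (div_le_iff₀ (hv j)).1 (hi j (Finset.mem_univ j))
  have hpos : 0 < ‖z i‖ := by
    by_contra hc
    have h0 : ‖z i‖ = 0 := le_antisymm (not_lt.1 hc) (norm_nonneg _)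
    refine hz (funext fun j => ?_)
    have := hle j
    rw [h0, zero_div, zero_mul] at this
    exact norm_le_zero_iff.1 this
  have key : ‖t‖ * ‖z i‖ ≤ s * ‖z i‖ := by
    have e := congrFun hzt i
    simp only [mulVec, dotProduct, Pi.smul_apply, smul_eq_mul, map_apply] at e
    calc ‖t‖ * ‖z i‖ = ‖∑ j, (X i j : ℂ) * z j‖ := by rw [e, norm_mul]
      _ ≤ ∑ j, X i j * ‖z j‖ := by
        refine (norm_sum_le _ _).trans (Finset.sum_le_sum fun j _ => ?_)
        rw [norm_mul, Complex.norm_real, Real.norm_of_nonneg (hX i j)]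
      _ ≤ ∑ j, ‖z i‖ / v i * (X i j * v j) := by
        refine Finset.sum_le_sum fun j _ => ?_
        calc _ ≤ X i j * (‖z i‖ / v i * v j) := mul_le_mul_of_nonneg_left (hle j) (hX i j)
          _ = _ := by ring
      _ = ‖z i‖ / v i * (X *ᵥ v) i := by rw [← Finset.mul_sum]; rfl
      _ ≤ ‖z i‖ / v i * (s * v i) :=
        mul_le_mul_of_nonneg_left (h i) (div_nonneg hpos.le (hv i).le)
      _ = s * ‖z i‖ := by field_simp [(hv i).ne']
  have := le_of_mul_le_mul_right key hpos
  exact ENNReal.coe_le_coe.2 (NNReal.coe_le_coe.1 (by simpa [Real.coe_toNNReal _ hs] using this))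

theorem abs_le_rho {X : Matrix (Fin d) (Fin d) ℝ} {v : Fin d → ℝ} (hv : v ≠ 0) {s : ℝ}
    (h : X *ᵥ v = s • v) : |s| ≤ rho X := by
  have hmem : (s : ℂ) ∈ spectrum ℂ (X.map (fun x : ℝ => (x : ℂ))) := by
    rw [mem_spectrum_iff_exists_mulVec_eq]
    refine ⟨fun i => (v i : ℂ), fun h0 => hv (funext fun i => by simpa using congrFun h0 i), ?_⟩
    funext i
    have := congrFun h i
    simp only [mulVec, dotProduct, Pi.smul_apply, smul_eq_mul, map_apply] at this ⊢
    exact_mod_cast this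
  have hfin : spectralRadius ℂ (X.map (fun x : ℝ => (x : ℂ))) ≠ ⊤ := by
    have hf := Matrix.finite_spectrum (X.map (fun x : ℝ => (x : ℂ)))
    obtain ⟨b, hb⟩ := (hf.image (fun k => ‖k‖₊)).bddAbove
    refine ne_top_of_le_ne_top (ENNReal.coe_ne_top (r := b)) (iSup₂_le fun t ht => ?_)
    exact ENNReal.coe_le_coe.2 (hb ⟨t, ht, rfl⟩)
  have hle : (‖(s : ℂ)‖₊ : ENNReal) ≤ spectralRadius ℂ (X.map (fun x : ℝ => (x : ℂ))) :=
    le_iSup₂ (f := fun k (_ : k ∈ spectrum ℂ (X.map (fun x : ℝ => (x : ℂ)))) =>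
      (‖k‖₊ : ENNReal)) (s : ℂ) hmem
  simpa [rho] using ENNReal.toReal_mono hfin hle

theorem rho_transpose (X : Matrix (Fin d) (Fin d) ℝ) : rho Xᵀ = rho X := by
  have : spectrum ℂ (Xᵀ.map (fun x : ℝ => (x : ℂ))) = spectrum ℂ (X.map (fun x : ℝ => (x : ℂ))) := by
    ext t
    rw [Matrix.mem_spectrum_iff_isRoot_charpoly, Matrix.mem_spectrum_iff_isRoot_charpoly,
      Matrix.transpose_map, Matrix.charpoly_transpose]
  simp only [rho, spectralRadius, this]

theorem rho_eq_one {X : Matrix (Fin d) (Fin d) ℝ} (hX : Nonneg X) {v : Fin d → ℝ}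
    (hv : ∀ i, 0 < v i) (hv0 : v ≠ 0) (h : X *ᵥ v = v) : rho X = 1 := by
  refine le_antisymm (rho_le_of_mulVec_le hX hv zero_le_one fun i => by simp [h]) ?_
  simpa using abs_le_rho hv0 (s := 1) (by simpa using h)

/-! ### Optimality conditions and monotonicity of the algorithm -/

/-- First-order optimality: at a positive solution `Y` the objective does not decrease in any
direction `H` that respects the active constraints. -/
theorem SolvesRight.sum_mul_le_zero {A Y H : Matrix (Fin d) (Fin d) ℝ} {v : Fin d → ℝ}
    (h : SolvesRight A v Y) (hY : ∀ i j, 0 < Y i j)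
    (hH : ∀ i, (H *ᵥ v) i ≤ 0 ∨ (Y *ᵥ v) i < v i) :
    ∑ i, ∑ j, (A - Y) i j * H i j ≤ 0 := by
  have hlim : ∀ a b : ℝ, Tendsto (fun ε : ℝ => a + ε * b) (𝓝[>] 0) (𝓝 a) := fun a b => by
    have : Tendsto (fun ε : ℝ => a + ε * b) (𝓝 0) (𝓝 (a + 0 * b)) :=
      Continuous.tendsto (by fun_prop) 0
    rw [zero_mul, add_zero] at this
    exact this.mono_left nhdsWithin_le_nhds
  have h1 : ∀ᶠ ε : ℝ in 𝓝[>] 0, ∀ i j, 0 < Y i j + ε * H i j :=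
    eventually_all.2 fun i => eventually_all.2 fun j =>
      (hlim _ _).eventually (lt_mem_nhds (hY i j))
  have h2 : ∀ᶠ ε : ℝ in 𝓝[>] 0, ∀ i, (Y *ᵥ v) i + ε * (H *ᵥ v) i ≤ v i := by
    refine eventually_all.2 fun i => ?_
    rcases hH i with hi | hi
    · filter_upwards [self_mem_nhdsWithin] with ε hε
      have := mul_nonpos_of_nonneg_of_nonpos (le_of_lt hε) hi
      linarith [h.1.2 i]
    · exact ((hlim _ _).eventually (gt_mem_nhds hi)).mono fun ε hε => le_of_lt hε
  have h3 : ∀ᶠ ε : ℝ in 𝓝[>] 0,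
      0 ≤ -(∑ i, ∑ j, (A - Y) i j * H i j) + ε * ((∑ i, ∑ j, H i j ^ 2) / 2) := by
    filter_upwards [h1, h2, self_mem_nhdsWithin] with ε e1 e2 e3
    have e3 : 0 < ε := e3
    have hle := h.2 (Y + ε • H) (fun i j => by simpa using (e1 i j).le) fun i => by
      simpa [add_mulVec, smul_mulVec] using e2 i
    have hsq : ‖Y - A‖ ^ 2 ≤ ‖Y + ε • H - A‖ ^ 2 := by gcongr
    rw [frobenius_norm_sq, frobenius_norm_sq] at hsq
    have hexp : ∑ i, ∑ j, (Y + ε • H - A) i j ^ 2 = ∑ i, ∑ j, (Y - A) i j ^ 2 +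
        (-(2 * ε) * ∑ i, ∑ j, (A - Y) i j * H i j + ε ^ 2 * ∑ i, ∑ j, H i j ^ 2) := by
      simp only [Finset.mul_sum, ← Finset.sum_add_distrib]
      refine Finset.sum_congr rfl fun i _ => Finset.sum_congr rfl fun j _ => ?_
      simp only [Matrix.sub_apply, Matrix.add_apply, Matrix.smul_apply, smul_eq_mul]
      ring
    rw [hexp] at hsq
    have : 0 ≤ ε * (-(∑ i, ∑ j, (A - Y) i j * H i j) + ε * ((∑ i, ∑ j, H i j ^ 2) / 2)) := by
      nlinarith
    exact nonneg_of_mul_nonneg_right this e3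
  have := ge_of_tendsto (hlim _ _) h3
  linarith

theorem sum_mul_vecMulVec (G : Matrix (Fin d) (Fin d) ℝ) (s v : Fin d → ℝ) :
    ∑ i, ∑ j, G i j * vecMulVec s v i j = s ⬝ᵥ (G *ᵥ v) := by
  simp only [vecMulVec_apply, dotProduct, mulVec, Finset.mul_sum]
  exact Finset.sum_congr rfl fun i _ => Finset.sum_congr rfl fun j _ => by ring

/-- Karush–Kuhn–Tucker conditions: a positive solution differs from `A` by a rank-one matrix
`t vᵀ`, `t ≥ 0`, and only rows with active constraints are moved. -/
theorem SolvesRight.exists_multiplier {A Y : Matrix (Fin d) (Fin d) ℝ} {v : Fin d → ℝ}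
    (h : SolvesRight A v Y) (hv : 0 < v ⬝ᵥ v) (hY : ∀ i j, 0 < Y i j) :
    ∃ t : Fin d → ℝ, (∀ i, 0 ≤ t i) ∧ A - Y = vecMulVec t v ∧
      ∀ i, t i * ((Y *ᵥ v) i - v i) = 0 := by
  set t : Fin d → ℝ := (v ⬝ᵥ v)⁻¹ • ((A - Y) *ᵥ v) with ht
  set H := (A - Y) - vecMulVec t v with hHdef
  have hHv : H *ᵥ v = 0 := by
    rw [hHdef, Matrix.sub_mulVec (A - Y), vecMulVec_mulVec, op_smul_eq_smul, ht,
      smul_inv_smul₀ hv.ne', sub_self]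
  have hG : A - Y = H + vecMulVec t v := by rw [hHdef]; abel
  have hH0 : H = 0 := by
    have h1 := h.sum_mul_le_zero (H := H) hY fun i => Or.inl (by rw [hHv]; simp)
    have h2 : ∑ i, ∑ j, (A - Y) i j * H i j = ∑ i, ∑ j, H i j ^ 2 := by
      have h3 := sum_mul_vecMulVec H t v
      rw [hHv, dotProduct_zero] at h3
      rw [← add_zero (∑ i, ∑ j, H i j ^ 2), ← h3, hG]
      simp only [← Finset.sum_add_distrib]
      refine Finset.sum_congr rfl fun i _ => Finset.sum_congr rfl fun j _ => ?_
      simp only [Matrix.add_apply]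
      ring
    rw [h2, ← frobenius_norm_sq] at h1
    exact norm_eq_zero.1 (pow_eq_zero_iff two_ne_zero |>.1 (le_antisymm h1 (sq_nonneg _)))
  rw [hH0, zero_add] at hG
  have hdir : ∀ (i : Fin d) (c : ℝ), (c ≤ 0 ∨ (Y *ᵥ v) i < v i) → c * t i ≤ 0 := by
    intro i c hc
    have h1 := h.sum_mul_le_zero (H := vecMulVec (Pi.single i c) v) hY fun k => by
      rw [vecMulVec_mulVec]
      by_cases hk : k = i
      · subst hk
        rcases hc with hc | hc
        · left
          simpa using mul_nonpos_of_nonpos_of_nonneg hc hv.le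
        · exact Or.inr hc
      · left
        simp [hk]
    rw [sum_mul_vecMulVec, single_dotProduct, hG, vecMulVec_mulVec] at h1
    have h1 : c * t i * (v ⬝ᵥ v) ≤ 0 := by simpa [mul_assoc] using h1
    exact nonpos_of_mul_nonpos_left h1 hv
  have ht0 : ∀ i, 0 ≤ t i := fun i => by linarith [hdir i (-1) (Or.inl (by norm_num))]
  refine ⟨t, ht0, hG, fun i => ?_⟩
  rcases (h.1.2 i).lt_or_eq with hi | hi
  · have := hdir i 1 (Or.inr hi)
    rw [le_antisymm (by linarith) (ht0 i), zero_mul]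
  · rw [hi, sub_self, mul_zero]

theorem SolvesRight.smul {A Y : Matrix (Fin d) (Fin d) ℝ} {v : Fin d → ℝ}
    (h : SolvesRight A v Y) {s : ℝ} (hs : 0 < s) : SolvesRight A (s • v) Y := by
  have key : ∀ Z : Matrix (Fin d) (Fin d) ℝ, (∀ i, (Z *ᵥ (s • v)) i ≤ (s • v) i) ↔
      ∀ i, (Z *ᵥ v) i ≤ v i := fun Z => by
    simp only [mulVec_smul, Pi.smul_apply, smul_eq_mul, mul_le_mul_iff_right₀ hs]
  exact ⟨⟨h.1.1, (key Y).2 h.1.2⟩, fun Z h1 h2 => h.2 Z h1 ((key Z).1 h2)⟩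

theorem dotProduct_pos [Nonempty (Fin d)] {v p : Fin d → ℝ} (hv : ∀ i, 0 < v i)
    (hp : ∀ i, 0 < p i) : 0 < v ⬝ᵥ p :=
  Finset.sum_pos (fun i _ => mul_pos (hv i) (hp i)) Finset.univ_nonempty

theorem RightStep.exists_normalized [Nonempty (Fin d)] {A X Y : Matrix (Fin d) (Fin d) ℝ}
    (h : RightStep A X Y) {p : Fin d → ℝ} (hp : ∀ i, 0 < p i) :
    ∃ v : Fin d → ℝ, (∀ i, 0 < v i) ∧ v ⬝ᵥ p = 1 ∧ X *ᵥ v = rho X • v ∧ SolvesRight A v Y := by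
  obtain ⟨v, hv, hX, hs⟩ := h
  have h0 := dotProduct_pos hv hp
  refine ⟨(v ⬝ᵥ p)⁻¹ • v, fun i => mul_pos (inv_pos.2 h0) (hv i), ?_, ?_, hs.smul (inv_pos.2 h0)⟩
  · rw [smul_dotProduct, smul_eq_mul, inv_mul_cancel₀ h0.ne']
  · rw [mulVec_smul, hX, smul_comm]

theorem SolvesLeft.transpose {A Y : Matrix (Fin d) (Fin d) ℝ} {u : Fin d → ℝ}
    (h : SolvesLeft A u Y) : SolvesRight Aᵀ u Yᵀ := by
  refine ⟨⟨fun i j => h.1.1 j i, fun i => by rw [mulVec_transpose]; exact h.1.2 i⟩,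
    fun Z h1 h2 => ?_⟩
  have := h.2 Zᵀ (fun i j => h1 j i) (fun i => by rw [vecMul_transpose]; exact h2 i)
  rw [← Matrix.frobenius_norm_transpose (Zᵀ - A)] at this
  rw [← Matrix.frobenius_norm_transpose (Y - A)] at this
  simpa using this

theorem LeftStep.transpose {A X Y : Matrix (Fin d) (Fin d) ℝ} (h : LeftStep A X Y) :
    RightStep Aᵀ Xᵀ Yᵀ := by
  obtain ⟨u, hu, hX, hs⟩ := h
  exact ⟨u, hu, by rw [mulVec_transpose, rho_transpose, hX], hs.transpose⟩

theorem RightStep.nonneg {A X Y : Matrix (Fin d) (Fin d) ℝ} (h : RightStep A X Y) : Nonneg Y := by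
  obtain ⟨v, -, -, hs⟩ := h
  exact hs.1.1

theorem RightStep.rho_le_one {A X Y : Matrix (Fin d) (Fin d) ℝ} (h : RightStep A X Y) :
    rho Y ≤ 1 := by
  obtain ⟨v, hv, -, hs⟩ := h
  exact rho_le_of_mulVec_le hs.1.1 hv zero_le_one fun i => by simpa using hs.1.2 i

/-- The current matrix is feasible for the next minimization, so the distance to `A` does not
grow. -/
theorem RightStep.norm_sub_le {A X Y : Matrix (Fin d) (Fin d) ℝ} (h : RightStep A X Y)
    (hX : Nonneg X) (hρ : rho X ≤ 1) : ‖Y - A‖ ≤ ‖X - A‖ := by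
  obtain ⟨v, hv, hXv, hs⟩ := h
  refine hs.2 X hX fun i => ?_
  rw [hXv]
  simpa using mul_le_mul_of_nonneg_right hρ (hv i).le

theorem IsRun.nonneg_and_rho_le_one {A : Matrix (Fin d) (Fin d) ℝ}
    {X : ℕ → Matrix (Fin d) (Fin d) ℝ} (h : IsRun A X) (k : ℕ) :
    Nonneg (X k) ∧ rho (X k) ≤ 1 := by
  cases k with
  | zero => exact ⟨h.1.1, h.1.2.1.le⟩
  | succ k =>
    rcases Nat.even_or_odd k with hk | hk
    · have := (h.2 k).1 hk
      exact ⟨this.nonneg, this.rho_le_one⟩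
    · have := ((h.2 k).2 hk).transpose
      exact ⟨fun i j => this.nonneg j i, by rw [← rho_transpose]; exact this.rho_le_one⟩

theorem IsRun.norm_sub_le {A : Matrix (Fin d) (Fin d) ℝ}
    {X : ℕ → Matrix (Fin d) (Fin d) ℝ} (h : IsRun A X) (k : ℕ) : ‖X k - A‖ ≤ ‖X 0 - A‖ := by
  induction k with
  | zero => exact le_rfl
  | succ k ih =>
    refine le_trans ?_ ih
    obtain ⟨h1, h2⟩ := h.nonneg_and_rho_le_one k
    rcases Nat.even_or_odd k with hk | hk
    · exact ((h.2 k).1 hk).norm_sub_le h1 h2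
    · have := ((h.2 k).2 hk).transpose.norm_sub_le (fun i j => h1 j i)
        (by rw [rho_transpose]; exact h2)
      rwa [← transpose_sub, ← transpose_sub, Matrix.frobenius_norm_transpose,
        Matrix.frobenius_norm_transpose] at this

theorem AlgorithmConverges.norm_sub_le {A Y L : Matrix (Fin d) (Fin d) ℝ}
    (h : AlgorithmConverges A Y L) : ‖L - A‖ ≤ ‖Y - A‖ := by
  obtain ⟨X, hX, rfl, hlim⟩ := h
  have : Tendsto (fun k => ‖X k - L‖ + ‖X 0 - A‖) atTop (𝓝 (0 + ‖X 0 - A‖)) :=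
    Tendsto.add hlim tendsto_const_nhds
  rw [zero_add] at this
  refine ge_of_tendsto' this fun k => ?_
  calc ‖L - A‖ = ‖(X k - A) - (X k - L)‖ := by congr 1; abel
    _ ≤ ‖X k - A‖ + ‖X k - L‖ := _root_.norm_sub_le _ _
    _ ≤ _ := by linarith [hX.norm_sub_le k]

/-! ### Passing to the limit -/

theorem tendsto_apply_of_tendsto_norm_sub {X : ℕ → Matrix (Fin d) (Fin d) ℝ}
    {L : Matrix (Fin d) (Fin d) ℝ} (h : Tendsto (fun k => ‖X k - L‖) atTop (𝓝 0)) (i j : Fin d) :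
    Tendsto (fun k => X k i j) atTop (𝓝 (L i j)) := by
  rw [tendsto_iff_norm_sub_tendsto_zero]
  exact squeeze_zero (fun _ => norm_nonneg _) (fun k => abs_apply_le_norm (X k - L) i j) h

theorem tendsto_mulVec_apply {X : ℕ → Matrix (Fin d) (Fin d) ℝ} {L : Matrix (Fin d) (Fin d) ℝ}
    (hX : ∀ i j, Tendsto (fun k => X k i j) atTop (𝓝 (L i j))) {x : ℕ → Fin d → ℝ}
    {v : Fin d → ℝ} (hx : ∀ j, Tendsto (fun k => x k j) atTop (𝓝 (v j))) (i : Fin d) :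
    Tendsto (fun k => (X k *ᵥ x k) i) atTop (𝓝 ((L *ᵥ v) i)) := by
  simp only [mulVec, dotProduct]
  exact tendsto_finsetSum _ fun j _ => (hX i j).mul (hx j)

theorem mulVec_pos {L : Matrix (Fin d) (Fin d) ℝ} (hL : ∀ i j, 0 < L i j) {v : Fin d → ℝ}
    (hv : ∀ i, 0 ≤ v i) (hs : v ⬝ᵥ 1 = 1) (i : Fin d) : 0 < (L *ᵥ v) i := by
  have hnn : ∀ j ∈ Finset.univ, 0 ≤ L i j * v j := fun j _ => mul_nonneg (hL i j).le (hv j)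
  refine lt_of_le_of_ne (Finset.sum_nonneg hnn) fun h0 => ?_
  have h1 := (Finset.sum_eq_zero_iff_of_nonneg hnn).1 h0.symm
  have : v ⬝ᵥ 1 = 0 := Finset.sum_eq_zero fun j hj => by
    rw [(mul_eq_zero.1 (h1 j hj)).resolve_left (hL i j).ne', zero_mul]
  rw [this] at hs
  exact zero_ne_one hs

/-- The bound `ρ ≤ 1` survives in a positive limit: normalized eigenvectors have a cluster point,
which is positive because the limit matrix is. -/
theorem rho_le_one_of_tendsto [Nonempty (Fin d)] {A L : Matrix (Fin d) (Fin d) ℝ}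
    {X Y : ℕ → Matrix (Fin d) (Fin d) ℝ} (h : ∀ k, RightStep A (X k) (Y k))
    (hY : ∀ i j, Tendsto (fun k => Y k i j) atTop (𝓝 (L i j))) (hL : ∀ i j, 0 < L i j) :
    rho L ≤ 1 := by
  choose v hv hv1 _ hs using fun k => (h k).exists_normalized (p := 1) fun _ => one_pos
  obtain ⟨w, hw, φ, hφ, hlim⟩ := (isCompact_stdSimplex ℝ (Fin d)).tendsto_subseq (x := v)
    fun k => ⟨fun i => (hv k i).le, by simpa [dotProduct] using hv1 k⟩
  rw [tendsto_pi_nhds] at hlim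
  have hle : ∀ i, (L *ᵥ w) i ≤ w i := fun i =>
    le_of_tendsto_of_tendsto' (tendsto_mulVec_apply
      (fun i j => (hY i j).comp hφ.tendsto_atTop) hlim i) (hlim i) fun k => (hs (φ k)).1.2 i
  have hpos := mulVec_pos hL hw.1 (by simpa [dotProduct] using hw.2)
  exact rho_le_of_mulVec_le (fun i j => (hL i j).le) (fun i => (hpos i).trans_le (hle i))
    zero_le_one fun i => by simpa using hle i

/-- Passing to the limit in the right steps: the multiplier structure survives, and the
eigenvectors, which are normalized rows of `A - Y k`, converge to a positive vector. -/
theorem exists_limit_multiplier [Nonempty (Fin d)] {A L : Matrix (Fin d) (Fin d) ℝ}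
    {X Y : ℕ → Matrix (Fin d) (Fin d) ℝ} (h : ∀ k, RightStep A (X k) (Y k))
    (hX : ∀ i j, Tendsto (fun k => X k i j) atTop (𝓝 (L i j)))
    (hY : ∀ i j, Tendsto (fun k => Y k i j) atTop (𝓝 (L i j)))
    (hL : ∀ i j, 0 < L i j) (hA : A ≠ L) :
    ∃ t v : Fin d → ℝ, (∀ i, 0 ≤ t i) ∧ (∀ i, 0 < v i) ∧ A - L = vecMulVec t v ∧
      ∀ i, t i * ((L *ᵥ v) i - v i) = 0 := by
  choose v hv hv1 hXv hs using fun k => (h k).exists_normalized (p := 1) fun _ => one_pos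
  have hYpos : ∀ᶠ k in atTop, ∀ i j, 0 < Y k i j :=
    eventually_all.2 fun i => eventually_all.2 fun j => (hY i j).eventually (lt_mem_nhds (hL i j))
  -- Since `v k` sums to one, the multiplier is the vector of row sums.
  set T : ℕ → Fin d → ℝ := fun k => (A - Y k) *ᵥ 1 with hT
  set t : Fin d → ℝ := (A - L) *ᵥ 1 with ht
  have hsub : ∀ i j, Tendsto (fun k => (A - Y k) i j) atTop (𝓝 ((A - L) i j)) :=
    fun i j => tendsto_const_nhds.sub (hY i j)
  have hTt : ∀ i, Tendsto (fun k => T k i) atTop (𝓝 (t i)) := fun i =>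
    tendsto_mulVec_apply hsub (fun _ => tendsto_const_nhds) i
  have hev : ∀ᶠ k in atTop, (∀ i, 0 ≤ T k i) ∧ A - Y k = vecMulVec (T k) (v k) ∧
      ∀ i, T k i * ((Y k *ᵥ v k) i - v k i) = 0 := by
    filter_upwards [hYpos] with k hk
    obtain ⟨s, h1, h2, h3⟩ := (hs k).exists_multiplier (dotProduct_pos (hv k) (hv k)) hk
    have : T k = s := by
      simp only [hT, h2, vecMulVec_mulVec, hv1 k]
      simp
    rw [this]
    exact ⟨h1, h2, h3⟩
  have ht0 : ∀ i, 0 ≤ t i := fun i => ge_of_tendsto (hTt i) (hev.mono fun k hk => hk.1 i)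
  have hv_le : ∀ k j, v k j ≤ 1 := fun k j => by
    rw [← hv1 k]
    simpa [dotProduct] using Finset.single_le_sum (f := v k) (fun i _ => (hv k i).le)
      (Finset.mem_univ j)
  obtain ⟨i₀, hi₀⟩ : ∃ i, 0 < t i := by
    by_contra! hc
    refine hA (sub_eq_zero.1 (Matrix.ext fun i j => ?_))
    have hz : Tendsto (fun k => T k i) atTop (𝓝 0) := by
      have := hTt i
      rwa [le_antisymm (hc i) (ht0 i)] at this
    refine tendsto_nhds_unique (hsub i j) ?_
    refine squeeze_zero' (hev.mono fun k hk => ?_) (hev.mono fun k hk => ?_) hz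
    · rw [hk.2.1]
      exact mul_nonneg (hk.1 i) (hv k j).le
    · rw [hk.2.1]
      exact mul_le_of_le_one_right (hk.1 i) (hv_le k j)
  set w : Fin d → ℝ := fun j => (A - L) i₀ j / t i₀ with hw
  have hvw : ∀ j, Tendsto (fun k => v k j) atTop (𝓝 (w j)) := fun j => by
    refine ((hsub i₀ j).div (hTt i₀) hi₀.ne').congr' ?_
    filter_upwards [hev, (hTt i₀).eventually (lt_mem_nhds hi₀)] with k hk hpos
    simp only [Pi.div_apply]
    rw [hk.2.1, vecMulVec_apply, mul_div_cancel_left₀ _ hpos.ne']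
  have hw0 : ∀ j, 0 ≤ w j := fun j => ge_of_tendsto' (hvw j) fun k => (hv k j).le
  have hw1 : w ⬝ᵥ 1 = 1 :=
    tendsto_nhds_unique (f := fun k => v k ⬝ᵥ 1)
      (tendsto_finsetSum _ fun j _ => (hvw j).mul tendsto_const_nhds)
      (by simp only [hv1]; exact tendsto_const_nhds)
  have hLw := mulVec_pos hL hw0 hw1
  -- Summing the eigenvalue equation recovers the eigenvalue.
  have hρ : Tendsto (fun k => rho (X k)) atTop (𝓝 ((L *ᵥ w) ⬝ᵥ 1)) := by
    have : ∀ k, rho (X k) = (X k *ᵥ v k) ⬝ᵥ 1 := fun k => by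
      rw [hXv k, smul_dotProduct, hv1 k, smul_eq_mul, mul_one]
    simp only [this]
    exact tendsto_finsetSum _ fun j _ => (tendsto_mulVec_apply hX hvw j).mul tendsto_const_nhds
  have hLw' : ∀ i, (L *ᵥ w) i = ((L *ᵥ w) ⬝ᵥ 1) * w i := fun i => by
    refine tendsto_nhds_unique (tendsto_mulVec_apply hX hvw i) ?_
    simp only [hXv]
    exact hρ.mul (hvw i)
  refine ⟨t, w, ht0, fun i => ?_, Matrix.ext fun i j => ?_, fun i => ?_⟩
  · refine (hw0 i).lt_of_ne fun h0 => (hLw i).ne' ?_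
    rw [hLw' i, ← h0, mul_zero]
  · refine tendsto_nhds_unique (hsub i j) (((hTt i).mul (hvw j)).congr' ?_)
    filter_upwards [hev] with k hk
    rw [hk.2.1, vecMulVec_apply]
  · refine tendsto_nhds_unique
      ((hTt i).mul ((tendsto_mulVec_apply hY hvw i).sub (hvw i))) ?_
    refine tendsto_const_nhds.congr' ?_
    filter_upwards [hev] with k hk
    rw [hk.2.2 i]

/-! ### The limit as a singular pair, and stability -/

theorem nonempty_of_one_lt_rho {A : Matrix (Fin d) (Fin d) ℝ} (h : 1 < rho A) :
    Nonempty (Fin d) := by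
  by_contra hc
  rw [not_nonempty_iff] at hc
  have := rho_le_of_mulVec_le (X := A) (fun i => hc.elim i) (v := 0) (fun i => hc.elim i)
    zero_le_one fun i => hc.elim i
  linarith

/-- `L = A - c u vᵀ`, where `v` and `u` are positive unit right and left singular vectors of
`A - 1` for the singular value `c > 0`. -/
structure IsSingularPair (A L : Matrix (Fin d) (Fin d) ℝ) (c : ℝ) (v u : Fin d → ℝ) : Prop where
  pos_right : ∀ i, 0 < v i
  pos_left : ∀ i, 0 < u i
  pos : 0 < c
  unit_right : v ⬝ᵥ v = 1
  unit_left : u ⬝ᵥ u = 1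
  mulVec_right : (A - 1) *ᵥ v = c • u
  mulVec_left : (A - 1)ᵀ *ᵥ u = c • v
  sub_eq : A - L = c • vecMulVec u v

theorem IsSingularPair.transpose {A L : Matrix (Fin d) (Fin d) ℝ} {c : ℝ} {v u : Fin d → ℝ}
    (h : IsSingularPair A L c v u) : IsSingularPair Aᵀ Lᵀ c u v where
  pos_right := h.pos_left
  pos_left := h.pos_right
  pos := h.pos
  unit_right := h.unit_left
  unit_left := h.unit_right
  mulVec_right := by simpa using h.mulVec_left
  mulVec_left := by simpa using h.mulVec_right
  sub_eq := by
    rw [← transpose_sub, h.sub_eq, transpose_smul, transpose_vecMulVec]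

theorem IsSingularPair.of_scaled [Nonempty (Fin d)] {A L : Matrix (Fin d) (Fin d) ℝ} {κ : ℝ}
    {v u : Fin d → ℝ} (hv : ∀ i, 0 < v i) (hu : ∀ i, 0 < u i) (hκ : 0 < κ)
    (hL : A - L = κ • vecMulVec u v) (hLv : L *ᵥ v = v) (hLu : Lᵀ *ᵥ u = u) :
    ∃ (c : ℝ) (v u : Fin d → ℝ), IsSingularPair A L c v u := by
  have hvv := dotProduct_pos hv hv
  have huu := dotProduct_pos hu hu
  obtain ⟨a, ha, haa⟩ : ∃ a : ℝ, 0 < a ∧ v ⬝ᵥ v = a * a :=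
    ⟨√(v ⬝ᵥ v), Real.sqrt_pos.2 hvv, (Real.mul_self_sqrt hvv.le).symm⟩
  obtain ⟨b, hb, hbb⟩ : ∃ b : ℝ, 0 < b ∧ u ⬝ᵥ u = b * b :=
    ⟨√(u ⬝ᵥ u), Real.sqrt_pos.2 huu, (Real.mul_self_sqrt huu.le).symm⟩
  have hAv : (A - 1) *ᵥ v = (κ * (a * a)) • u := by
    have : (A - 1) *ᵥ v = (A - L) *ᵥ v := by
      rw [Matrix.sub_mulVec, Matrix.sub_mulVec, hLv, one_mulVec]
    rw [this, hL, smul_mulVec, vecMulVec_mulVec, op_smul_eq_smul, haa, smul_smul]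
  have hAu : (A - 1)ᵀ *ᵥ u = (κ * (b * b)) • v := by
    have : (A - 1)ᵀ *ᵥ u = (A - L)ᵀ *ᵥ u := by
      rw [transpose_sub, transpose_sub, Matrix.sub_mulVec, Matrix.sub_mulVec, hLu, transpose_one,
        one_mulVec]
    rw [this, hL, transpose_smul, transpose_vecMulVec, smul_mulVec, vecMulVec_mulVec,
      op_smul_eq_smul, hbb, smul_smul]
  refine ⟨κ * a * b, a⁻¹ • v, b⁻¹ • u, fun i => mul_pos (inv_pos.2 ha) (hv i),
    fun i => mul_pos (inv_pos.2 hb) (hu i), by positivity, ?_, ?_, ?_, ?_, ?_⟩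
  · rw [smul_dotProduct, dotProduct_smul, haa]
    simp only [smul_eq_mul]
    field_simp
  · rw [smul_dotProduct, dotProduct_smul, hbb]
    simp only [smul_eq_mul]
    field_simp
  · rw [mulVec_smul, hAv, smul_smul, smul_smul]
    congr 1
    field_simp
  · rw [mulVec_smul, hAu, smul_smul, smul_smul]
    congr 1
    field_simp
  · rw [hL, smul_vecMulVec, vecMulVec_smul, smul_smul, smul_smul]
    congr 1
    field_simp

/-- The limits along even and odd steps exhibit `A - L` as `t vᵀ` and as `u sᵀ`. -/
theorem exists_isSingularPair [Nonempty (Fin d)] {A L : Matrix (Fin d) (Fin d) ℝ}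
    {X : ℕ → Matrix (Fin d) (Fin d) ℝ} (hρ : 1 < rho A) (hX : IsRun A X) (hlim : ConvergesTo X L)
    (hL : ∀ i j, 0 < L i j) : ∃ (c : ℝ) (v u : Fin d → ℝ), IsSingularPair A L c v u := by
  have hent := tendsto_apply_of_tendsto_norm_sub hlim
  have hsub : ∀ m, Tendsto (fun k : ℕ => 2 * k + m) atTop atTop := fun m =>
    tendsto_atTop_mono (fun k => show k ≤ 2 * k + m by omega) tendsto_id
  have hX0 : ∀ m i j, Tendsto (fun k : ℕ => X (2 * k + m) i j) atTop (𝓝 (L i j)) :=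
    fun m i j => (hent i j).comp (hsub m)
  have hR : ∀ k, RightStep A (X (2 * k + 0)) (X (2 * k + 1)) := fun k =>
    (hX.2 (2 * k)).1 (even_two_mul k)
  have hRT : ∀ k, RightStep Aᵀ (X (2 * k + 1))ᵀ (X (2 * k + 2))ᵀ := fun k =>
    ((hX.2 (2 * k + 1)).2 (odd_two_mul_add_one k)).transpose
  have hAL : A ≠ L := by
    rintro rfl
    exact absurd (rho_le_one_of_tendsto hR (hX0 1) hL) (not_le.2 hρ)
  obtain ⟨t, v, ht, hv, htv, hLv⟩ := exists_limit_multiplier hR (hX0 0) (hX0 1) hL hAL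
  obtain ⟨s, u, hs, hu, hsu, hLu⟩ := exists_limit_multiplier hRT (fun i j => hX0 1 j i)
    (fun i j => hX0 2 j i) (L := Lᵀ) (fun i j => hL j i) (fun h => hAL (transpose_injective h))
  have hus : A - L = vecMulVec u s := by
    rw [← transpose_sub] at hsu
    rw [← transpose_transpose (A - L), hsu, transpose_vecMulVec]
  have hvv := dotProduct_pos hv hv
  set κ := (s ⬝ᵥ v) / (v ⬝ᵥ v) with hκ
  have htu : t = κ • u := by
    have h1 : (A - L) *ᵥ v = (v ⬝ᵥ v) • t := by rw [htv, vecMulVec_mulVec, op_smul_eq_smul]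
    have h2 : (A - L) *ᵥ v = (s ⬝ᵥ v) • u := by rw [hus, vecMulVec_mulVec, op_smul_eq_smul]
    rw [hκ, div_eq_inv_mul, ← smul_smul, ← h2, h1, inv_smul_smul₀ hvv.ne']
  have hκ0 : 0 < κ := by
    have h0 : 0 ≤ κ := div_nonneg (Finset.sum_nonneg fun i _ => mul_nonneg (hs i) (hv i).le) hvv.le
    refine h0.lt_of_ne fun h => hAL (sub_eq_zero.1 ?_)
    rw [htv, htu, ← h, zero_smul, zero_vecMulVec]
  have hALκ : A - L = κ • vecMulVec u v := by rw [htv, htu, smul_vecMulVec]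
  have hsv : s = κ • v := by
    funext j
    obtain ⟨i⟩ := ‹Nonempty (Fin d)›
    have := congrFun (congrFun (hus.symm.trans hALκ) i) j
    simp only [vecMulVec_apply, Matrix.smul_apply, smul_eq_mul] at this
    refine mul_left_cancel₀ (hu i).ne' ?_
    simp only [Pi.smul_apply, smul_eq_mul]
    linarith
  refine IsSingularPair.of_scaled hv hu hκ0 hALκ (funext fun i => ?_) (funext fun i => ?_)
  · have h1 := hLv i
    rw [htu] at h1
    exact sub_eq_zero.1 ((mul_eq_zero.1 h1).resolve_left (mul_pos hκ0 (hu i)).ne')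
  · have h1 := hLu i
    rw [hsv] at h1
    exact sub_eq_zero.1 ((mul_eq_zero.1 h1).resolve_left (mul_pos hκ0 (hv i)).ne')

theorem IsSingularPair.norm_sub {A L : Matrix (Fin d) (Fin d) ℝ} {c : ℝ} {v u : Fin d → ℝ}
    (h : IsSingularPair A L c v u) : ‖L - A‖ ^ 2 = c ^ 2 := by
  rw [norm_sub_rev, h.sub_eq, ← smul_vecMulVec, frobenius_norm_sq_vecMulVec, smul_dotProduct,
    dotProduct_smul, h.unit_left, h.unit_right]
  simp [sq]

/-- The matrix `A - (A - 1) w wᵀ / (w · w)`: the point closest to `A` among the matrices that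
fix `w`. -/
noncomputable def closestFixing (A : Matrix (Fin d) (Fin d) ℝ) (w : Fin d → ℝ) :
    Matrix (Fin d) (Fin d) ℝ :=
  A - (w ⬝ᵥ w)⁻¹ • vecMulVec ((A - 1) *ᵥ w) w

theorem closestFixing_mulVec (A : Matrix (Fin d) (Fin d) ℝ) {w : Fin d → ℝ} (hw : w ⬝ᵥ w ≠ 0) :
    closestFixing A w *ᵥ w = w := by
  rw [closestFixing, Matrix.sub_mulVec, smul_mulVec, vecMulVec_mulVec, op_smul_eq_smul,
    inv_smul_smul₀ hw, Matrix.sub_mulVec, one_mulVec, sub_sub_cancel]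

theorem norm_sq_closestFixing_sub (A : Matrix (Fin d) (Fin d) ℝ) {w : Fin d → ℝ}
    (hw : w ⬝ᵥ w ≠ 0) :
    ‖closestFixing A w - A‖ ^ 2 = (((A - 1) *ᵥ w) ⬝ᵥ ((A - 1) *ᵥ w)) / (w ⬝ᵥ w) := by
  rw [norm_sub_rev, closestFixing, sub_sub_cancel, ← smul_vecMulVec, frobenius_norm_sq_vecMulVec,
    smul_dotProduct, dotProduct_smul]
  simp only [smul_eq_mul]
  field_simp

theorem IsSingularPair.closestFixing_eq {A L : Matrix (Fin d) (Fin d) ℝ} {c : ℝ} {v u : Fin d → ℝ}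
    (h : IsSingularPair A L c v u) : closestFixing A v = L := by
  rw [closestFixing, h.unit_right, inv_one, one_smul, h.mulVec_right, smul_vecMulVec, ← h.sub_eq,
    sub_sub_cancel]

theorem continuousAt_closestFixing_apply (A : Matrix (Fin d) (Fin d) ℝ) {w : ℝ → Fin d → ℝ}
    {s : ℝ} (hw : ContinuousAt w s) (h0 : w s ⬝ᵥ w s ≠ 0) (i j : Fin d) :
    ContinuousAt (fun e => closestFixing A (w e) i j) s := by
  have hc : ∀ k, ContinuousAt (fun e => w e k) s := fun k => continuousAt_pi.1 hw k
  have h1 : ContinuousAt (fun e => w e ⬝ᵥ w e) s := by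
    simp only [dotProduct]
    exact tendsto_finsetSum _ fun k _ => (hc k).mul (hc k)
  have h2 : ContinuousAt (fun e => ((A - 1) *ᵥ w e) i) s := by
    simp only [mulVec, dotProduct]
    exact tendsto_finsetSum _ fun k _ => continuousAt_const.mul (hc k)
  simp only [closestFixing, Matrix.sub_apply, Matrix.smul_apply, vecMulVec_apply, smul_eq_mul]
  exact continuousAt_const.sub ((h1.inv₀ h0).mul (h2.mul (hc j)))

/-- Stability forces `c` to be the smallest singular value of `A - 1`. If the Rayleigh quotient of
`(A - 1)ᵀ (A - 1)` were smaller at some `x`, then the matrices `closestFixing A (v + ε x)` would be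
admissible starts arbitrarily close to `L` but closer to `A` than `L`; since the distance to `A`
never grows along a run, a run started there could not converge to `L`. -/
theorem IsSingularPair.le_rayleigh [Nonempty (Fin d)] {A L : Matrix (Fin d) (Fin d) ℝ} {c : ℝ}
    {v u : Fin d → ℝ} (h : IsSingularPair A L c v u) {X : ℕ → Matrix (Fin d) (Fin d) ℝ}
    (hX : StablyConverges A X L) (hL : ∀ i j, 0 < L i j) (x : Fin d → ℝ) :
    c ^ 2 * (x ⬝ᵥ x) ≤ ((A - 1) *ᵥ x) ⬝ᵥ ((A - 1) *ᵥ x) := by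
  by_contra! hlt
  obtain ⟨-, hconv, ε, hε, N, hstab⟩ := hX
  obtain ⟨k, hkN, hk⟩ : ∃ k, N < k ∧ ‖X k - L‖ < ε / 2 :=
    ((eventually_gt_atTop N).and (hconv.eventually (gt_mem_nhds (half_pos hε)))).exists
  set w : ℝ → Fin d → ℝ := fun e => v + e • x with hw
  have hw0 : w 0 = v := by simp [hw]
  have hwc : Continuous w := by fun_prop
  have hvv : w 0 ⬝ᵥ w 0 ≠ 0 := by rw [hw0, h.unit_right]; exact one_ne_zero
  have hZ : ∀ i j, ContinuousAt (fun e => closestFixing A (w e) i j) 0 :=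
    continuousAt_closestFixing_apply A hwc.continuousAt hvv
  have e1 : ∀ᶠ e in 𝓝 (0 : ℝ), ∀ i, 0 < w e i := eventually_all.2 fun i =>
    ((continuous_apply i).comp hwc).continuousAt.eventually
      (lt_mem_nhds (by simpa [hw0] using h.pos_right i))
  have e2 : ∀ᶠ e in 𝓝 (0 : ℝ), ∀ i j, 0 < closestFixing A (w e) i j :=
    eventually_all.2 fun i => eventually_all.2 fun j =>
      (hZ i j).eventually (lt_mem_nhds (by simpa only [hw0, h.closestFixing_eq] using hL i j))
  have e3 : ∀ᶠ e in 𝓝 (0 : ℝ), ‖closestFixing A (w e) - L‖ ^ 2 < (ε / 2) ^ 2 := by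
    have hc : ContinuousAt (fun e => ‖closestFixing A (w e) - L‖ ^ 2) 0 := by
      simp only [frobenius_norm_sq, Matrix.sub_apply]
      exact tendsto_finsetSum _ fun i _ => tendsto_finsetSum _ fun j _ =>
        ((hZ i j).sub continuousAt_const).pow 2
    refine hc.eventually (gt_mem_nhds ?_)
    simp only [hw0, h.closestFixing_eq, sub_self, norm_zero, zero_pow two_ne_zero]
    positivity
  obtain ⟨e, he0, he1, he2, he3⟩ : ∃ e : ℝ, 0 < e ∧ (∀ i, 0 < w e i) ∧
      (∀ i j, 0 < closestFixing A (w e) i j) ∧ ‖closestFixing A (w e) - L‖ ^ 2 < (ε / 2) ^ 2 :=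
    ((eventually_mem_nhdsWithin (a := (0 : ℝ)) (s := Set.Ioi 0)).and
      ((e1.and (e2.and e3)).filter_mono nhdsWithin_le_nhds)).exists
  have hwpos := dotProduct_pos he1 he1
  have hstart : IsStart A (closestFixing A (w e)) := by
    refine ⟨fun i j => (he2 i j).le, rho_eq_one (fun i j => (he2 i j).le) he1 ?_
      (closestFixing_mulVec A hwpos.ne'), fun i j _ => he2 i j⟩
    intro h0
    rw [h0, dotProduct_zero] at hwpos
    exact lt_irrefl _ hwpos
  have hclose : ‖closestFixing A (w e) - X k‖ < ε := by
    have := lt_of_pow_lt_pow_left₀ 2 (half_pos hε).le he3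
    calc _ = ‖(closestFixing A (w e) - L) - (X k - L)‖ := by congr 1; abel
      _ ≤ _ := _root_.norm_sub_le _ _
      _ < ε := by linarith
  have hle := (hstab k hkN _ hstart hclose).norm_sub_le
  have hsq : ‖L - A‖ ^ 2 ≤ ‖closestFixing A (w e) - A‖ ^ 2 := by gcongr
  rw [h.norm_sub, norm_sq_closestFixing_sub A hwpos.ne', le_div_iff₀ hwpos] at hsq
  -- The first-order terms cancel because `v` is an eigenvector of `(A - 1)ᵀ (A - 1)`.
  have hcross : ((A - 1) *ᵥ v) ⬝ᵥ ((A - 1) *ᵥ x) = c ^ 2 * (v ⬝ᵥ x) := by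
    rw [dotProduct_mulVec, ← mulVec_transpose, h.mulVec_right, mulVec_smul, h.mulVec_left,
      smul_smul, smul_dotProduct, smul_eq_mul, sq]
  have hself : ((A - 1) *ᵥ v) ⬝ᵥ ((A - 1) *ᵥ v) = c ^ 2 := by
    rw [h.mulVec_right, smul_dotProduct, dotProduct_smul, h.unit_left]
    simp [sq]
  have hexp1 : w e ⬝ᵥ w e = 1 + 2 * e * (v ⬝ᵥ x) + e ^ 2 * (x ⬝ᵥ x) := by
    simp only [hw, add_dotProduct, dotProduct_add, smul_dotProduct, dotProduct_smul, smul_eq_mul,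
      h.unit_right, dotProduct_comm x v]
    ring
  have hexp2 : ((A - 1) *ᵥ w e) ⬝ᵥ ((A - 1) *ᵥ w e) = c ^ 2 + 2 * e * (c ^ 2 * (v ⬝ᵥ x)) +
      e ^ 2 * (((A - 1) *ᵥ x) ⬝ᵥ ((A - 1) *ᵥ x)) := by
    rw [← hcross]
    nth_rw 1 [← hself]
    simp only [hw, mulVec_add, mulVec_smul, add_dotProduct, dotProduct_add, smul_dotProduct,
      dotProduct_smul, smul_eq_mul, dotProduct_comm ((A - 1) *ᵥ x) ((A - 1) *ᵥ v)]
    ring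
  rw [hexp1, hexp2] at hsq
  have : 0 < e ^ 2 * (c ^ 2 * (x ⬝ᵥ x) - ((A - 1) *ᵥ x) ⬝ᵥ ((A - 1) *ᵥ x)) :=
    mul_pos (pow_pos he0 2) (sub_pos.2 hlt)
  linarith

/-! ### Global minimality and the explicit form -/

/-- If `(1 - Z) x = 1` with `Z ≥ 0` and `x ≥ 0`, then `x = 1 + Z x ≥ 1`. -/
theorem one_le_of_nonneg_of_sub_mulVec {Z : Matrix (Fin d) (Fin d) ℝ} (hZ : Nonneg Z)
    {x : Fin d → ℝ} (hx : ∀ i, 0 ≤ x i) (h : (1 - Z) *ᵥ x = 1) (i : Fin d) : 1 ≤ x i := by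
  have h1 := congrFun h i
  rw [Matrix.sub_mulVec, one_mulVec, Pi.sub_apply, Pi.one_apply] at h1
  have : 0 ≤ (Z *ᵥ x) i := by
    simp only [mulVec, dotProduct]
    exact Finset.sum_nonneg fun j _ => mul_nonneg (hZ i j) (hx j)
  linarith

theorem sub_mulVec_inv_mulVec_one {Z : Matrix (Fin d) (Fin d) ℝ} (h : (1 - Z).det ≠ 0) :
    (1 - Z) *ᵥ ((1 - Z)⁻¹ *ᵥ 1) = 1 := by
  rw [mulVec_mulVec, mul_nonsing_inv _ (isUnit_iff_ne_zero.2 h), one_mulVec]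

/-- Non-negativity of `(1 - Z)⁻¹ 1` propagates along a segment of non-negative matrices on which
`1 - Z` stays invertible: a non-negative such vector has all entries at least `1`, so its smallest
entry cannot become negative without taking the forbidden value `1 / 2`. -/
theorem inv_mulVec_one_nonneg_of_segment [Nonempty (Fin d)] {Y Z : Matrix (Fin d) (Fin d) ℝ}
    (hY : Nonneg Y) (hZ : Nonneg Z)
    (hdet : ∀ s ∈ Set.Icc (0 : ℝ) 1, (1 - (Y + s • (Z - Y))).det ≠ 0)
    (h0 : ∀ i, 0 ≤ ((1 - Y)⁻¹ *ᵥ 1) i) (i : Fin d) : 0 ≤ ((1 - Z)⁻¹ *ᵥ 1) i := by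
  set P : ℝ → Matrix (Fin d) (Fin d) ℝ := fun s => Y + s • (Z - Y) with hP
  have hPnn : ∀ s ∈ Set.Icc (0 : ℝ) 1, Nonneg (P s) := fun s hs i j => by
    have : P s i j = (1 - s) * Y i j + s * Z i j := by
      simp only [hP, Matrix.add_apply, Matrix.smul_apply, Matrix.sub_apply, smul_eq_mul]
      ring
    rw [this]
    exact add_nonneg (mul_nonneg (by linarith [hs.2]) (hY i j)) (mul_nonneg hs.1 (hZ i j))
  have hcont : Continuous fun s => 1 - P s := continuous_matrix fun i j => by
    simp only [hP, Matrix.add_apply, Matrix.smul_apply, Matrix.sub_apply, smul_eq_mul]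
    fun_prop
  have hx : ∀ i, ContinuousOn (fun s => ((1 - P s)⁻¹ *ᵥ 1) i) (Set.Icc 0 1) := fun i => by
    have e : ∀ s, ((1 - P s)⁻¹ *ᵥ 1) i = ((1 - P s).det)⁻¹ * ((1 - P s).adjugate *ᵥ 1) i := by
      intro s
      rw [Matrix.inv_def, Ring.inverse_eq_inv', smul_mulVec, Pi.smul_apply, smul_eq_mul]
    simp only [e]
    refine ContinuousOn.mul (hcont.matrix_det.continuousOn.inv₀ hdet) (Continuous.continuousOn ?_)
    have h1 := hcont.matrix_adjugate
    simp only [mulVec, dotProduct]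
    exact continuous_finsetSum _ fun j _ => (h1.matrix_elem i j).mul continuous_const
  set m : ℝ → ℝ := fun s =>
    Finset.univ.inf' Finset.univ_nonempty (fun i => ((1 - P s)⁻¹ *ᵥ 1) i) with hm
  have hmc : ContinuousOn m (Set.Icc 0 1) :=
    ContinuousOn.finset_inf'_apply Finset.univ_nonempty fun i _ => hx i
  have hone : ∀ s ∈ Set.Icc (0 : ℝ) 1, 0 ≤ m s → 1 ≤ m s := fun s hs h =>
    Finset.le_inf' _ _ fun i _ => one_le_of_nonneg_of_sub_mulVec (hPnn s hs)
      (fun j => h.trans (Finset.inf'_le _ (Finset.mem_univ j)))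
      (sub_mulVec_inv_mulVec_one (hdet s hs)) i
  have hm0 : 1 ≤ m 0 := hone 0 (by simp) (Finset.le_inf' _ _ fun i _ => by simpa [hP] using h0 i)
  have hm1 : 0 ≤ m 1 := by
    by_contra! hlt
    obtain ⟨s, hs, hms⟩ := intermediate_value_Icc' zero_le_one hmc
      (show (1 / 2 : ℝ) ∈ Set.Icc (m 1) (m 0) from ⟨by linarith, by linarith⟩)
    have := hone s hs (by rw [hms]; norm_num)
    rw [hms] at this
    norm_num at this
  have := hm1.trans (Finset.inf'_le (fun i => ((1 - P 1)⁻¹ *ᵥ 1) i) (Finset.mem_univ i))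
  simpa [hP] using this

/-- A non-negative matrix with spectral radius at most one cannot be closer to `A` than the
smallest singular value of `A - 1`. Otherwise `1 - Z` is invertible for all `Z` on the segments
from `0` to `Y` and from `Y` to `A`, so `(1 - A)⁻¹ 1` is non-negative and certifies `ρ(A) ≤ 1`. -/
theorem le_norm_sub_of_rho_le_one [Nonempty (Fin d)] {A Y : Matrix (Fin d) (Fin d) ℝ} {c : ℝ}
    (hA : Nonneg A) (hρ : 1 < rho A)
    (hB : ∀ x, c ^ 2 * (x ⬝ᵥ x) ≤ ((A - 1) *ᵥ x) ⬝ᵥ ((A - 1) *ᵥ x))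
    (hY : Nonneg Y) (hYρ : rho Y ≤ 1) : c ≤ ‖Y - A‖ := by
  by_contra! hlt
  have hdet : ∀ Z : Matrix (Fin d) (Fin d) ℝ, ‖Z - A‖ ≤ ‖Y - A‖ → (1 - Z).det ≠ 0 := by
    intro Z hZ h0
    obtain ⟨x, hx, hx0⟩ := Matrix.exists_mulVec_eq_zero_iff.2 h0
    have hZx : Z *ᵥ x = x := by
      rw [Matrix.sub_mulVec, one_mulVec, sub_eq_zero] at hx0
      exact hx0.symm
    have h1 := mulVec_dotProduct_self_le (A - Z) x
    rw [Matrix.sub_mulVec, hZx, ← one_mulVec x, mulVec_mulVec, mul_one, ← Matrix.sub_mulVec,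
      one_mulVec, norm_sub_rev] at h1
    have h2 := dotProduct_self_pos_of_ne_zero hx
    have h3 : c ^ 2 ≤ ‖Z - A‖ ^ 2 := le_of_mul_le_mul_right ((hB x).trans h1) h2
    have h4 : ‖Z - A‖ ^ 2 < c ^ 2 := pow_lt_pow_left₀ (hZ.trans_lt hlt) (norm_nonneg _) two_ne_zero
    linarith
  have hY1 : ∀ i, 0 ≤ ((1 - Y)⁻¹ *ᵥ 1) i := by
    refine inv_mulVec_one_nonneg_of_segment (Y := 0) (fun i j => le_rfl) hY ?_ fun i => by simp
    intro s hs
    rw [zero_add, sub_zero]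
    rcases hs.2.lt_or_eq with h1 | h1
    · intro h0
      obtain ⟨x, hx, hx0⟩ := Matrix.exists_mulVec_eq_zero_iff.2 h0
      rw [Matrix.sub_mulVec, one_mulVec, smul_mulVec, sub_eq_zero] at hx0
      have hs0 : 0 < s := hs.1.lt_of_ne fun h => hx (by rw [hx0, ← h, zero_smul])
      have h2 := abs_le_rho hx (X := Y) (s := s⁻¹) (by
        nth_rw 2 [hx0]
        rw [inv_smul_smul₀ hs0.ne'])
      have h3 : 1 < s⁻¹ := (one_lt_inv₀ hs0).2 h1
      linarith [le_abs_self s⁻¹]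
    · rw [h1, one_smul]
      exact hdet Y le_rfl
  have hA1 := inv_mulVec_one_nonneg_of_segment hY hA (fun s hs => hdet _ (by
    have : Y + s • (A - Y) - A = (1 - s) • (Y - A) := by
      rw [sub_smul, one_smul, smul_sub, smul_sub]; abel
    rw [this]
    have hsq : ‖(1 - s) • (Y - A)‖ ^ 2 ≤ ‖Y - A‖ ^ 2 := by
      rw [frobenius_norm_sq, frobenius_norm_sq]
      refine Finset.sum_le_sum fun i _ => Finset.sum_le_sum fun j _ => ?_
      rw [Matrix.smul_apply, smul_eq_mul, mul_pow]
      exact mul_le_of_le_one_left (sq_nonneg _)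
        (pow_le_one₀ (by linarith [hs.2]) (by linarith [hs.1]))
    exact le_of_sq_le_sq hsq (norm_nonneg _))) hY1
  have hAx := sub_mulVec_inv_mulVec_one (hdet A (by simp))
  have hpos := one_le_of_nonneg_of_sub_mulVec hA hA1 hAx
  refine absurd (rho_le_of_mulVec_le hA (fun i => one_pos.trans_le (hpos i)) zero_le_one
    fun i => ?_) (not_le.2 hρ)
  have := congrFun hAx i
  rw [Matrix.sub_mulVec, one_mulVec, Pi.sub_apply, Pi.one_apply] at this
  linarith

theorem IsSingularPair.isExplicitMatrix {A L : Matrix (Fin d) (Fin d) ℝ} {c : ℝ}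
    {v u : Fin d → ℝ} (h : IsSingularPair A L c v u) (hL : ∀ i j, 0 < L i j)
    (hB : ∀ x, c ^ 2 * (x ⬝ᵥ x) ≤ ((A - 1) *ᵥ x) ⬝ᵥ ((A - 1) *ᵥ x)) : IsExplicitMatrix A L := by
  have hM : matM A = (A - 1)ᵀ * (A - 1) := by
    rw [matM, ← neg_sub A 1, ← transpose_one, ← transpose_sub, ← neg_sub A 1, transpose_neg,
      transpose_one, neg_mul_neg]
  have hMv : matM A *ᵥ v = c ^ 2 • v := by
    rw [hM, ← mulVec_mulVec, h.mulVec_right, mulVec_smul, h.mulVec_left, smul_smul, sq]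
  have hv0 : v ≠ 0 := by
    rintro rfl
    simpa using h.unit_right
  have h1Av : (1 - A) *ᵥ v = -c • u := by
    rw [← neg_sub A 1, neg_mulVec, h.mulVec_right, neg_smul]
  refine ⟨c ^ 2, -c, v, u, ⟨?_, ?_⟩, pow_pos h.pos 2, hMv, h.unit_right, fun i => (h.pos_right i).le,
    by rw [Real.sqrt_sq h.pos.le], ?_, fun i => (h.pos_left i).le, ?_, fun i j => (hL i j).le⟩
  · exact Module.End.hasEigenvalue_of_hasEigenvector (x := v)
      ⟨Module.End.mem_eigenspace_iff.2 (by simpa using hMv), hv0⟩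
  · intro t ht
    obtain ⟨x, hx⟩ := Module.End.HasEigenvalue.exists_hasEigenvector ht
    have hx1 : matM A *ᵥ x = t • x := by simpa using hx.apply_eq_smul
    have hx2 := dotProduct_self_pos_of_ne_zero hx.2
    refine le_of_mul_le_mul_right ((hB x).trans_eq ?_) hx2
    rw [dotProduct_mulVec, ← mulVec_transpose, mulVec_mulVec, ← hM, hx1, smul_dotProduct,
      smul_eq_mul]
  · rw [h1Av, inv_smul_smul₀ (neg_ne_zero.2 h.pos.ne')]
  · rw [neg_smul, ← h.sub_eq]
    abel

/-! ### Singular values and expansion on the orthogonal complement -/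

section SingularValues

variable {E : Type*} [NormedAddCommGroup E] [InnerProductSpace ℝ E] [FiniteDimensional ℝ E]
  {n : ℕ}

theorem norm_sq_apply_eq_sum_singularValues (hn : Module.finrank ℝ E = n) (T : E →ₗ[ℝ] E)
    (x : E) :
    ‖T x‖ ^ 2 = ∑ i : Fin n, T.singularValues i ^ 2 *
      inner ℝ (T.isSymmetric_adjoint_comp_self.eigenvectorBasis hn i) x ^ 2 := by
  rw [← real_inner_self_eq_norm_sq, ← LinearMap.adjoint_inner_left, ← LinearMap.comp_apply,
    ← (T.isSymmetric_adjoint_comp_self.eigenvectorBasis hn).sum_inner_mul_inner]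
  refine Finset.sum_congr rfl fun i _ => ?_
  have h1 := T.isSymmetric_adjoint_comp_self
    (T.isSymmetric_adjoint_comp_self.eigenvectorBasis hn i) x
  rw [LinearMap.IsSymmetric.apply_eigenvectorBasis, real_inner_smul_left] at h1
  rw [real_inner_comm, ← h1, T.sq_singularValues_fin hn i]
  simp only [RCLike.ofReal_real_eq_id, id]
  ring

/-- If `c²` is attained as an eigenvalue of `T† T` and bounds its Rayleigh quotient from below,
then `c` is the smallest singular value. -/
theorem singularValues_last_eq (hn : Module.finrank ℝ E = n) (T : E →ₗ[ℝ] E) {c : ℝ} {v : E}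
    (hT : ∀ x, c ^ 2 * ‖x‖ ^ 2 ≤ ‖T x‖ ^ 2) (hv : v ≠ 0)
    (hTv : T.adjoint (T v) = (c ^ 2) • v) (hc : 0 ≤ c) : T.singularValues (n - 1) = c := by
  obtain ⟨i, hi⟩ := T.isSymmetric_adjoint_comp_self.exists_eigenvalues_eq hn (μ := c ^ 2)
    (Module.End.hasEigenvalue_of_hasEigenvector
      ⟨Module.End.mem_eigenspace_iff.2 (by simpa using hTv), hv⟩)
  have hi' : T.singularValues i ^ 2 = c ^ 2 := by
    rw [T.sq_singularValues_fin hn i]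
    simpa using hi
  have hic : T.singularValues i = c :=
    (pow_left_inj₀ (T.singularValues_nonneg i) hc two_ne_zero).1 hi'
  refine le_antisymm (hic ▸ T.singularValues_antitone (by omega)) ?_
  have hlt : n - 1 < n := by have := i.2; omega
  set j : Fin n := ⟨n - 1, hlt⟩
  set b := T.isSymmetric_adjoint_comp_self.eigenvectorBasis hn with hb
  have h1 := hT (b j)
  rw [norm_sq_apply_eq_sum_singularValues hn T, ← hb, Finset.sum_eq_single j] at h1
  · rw [real_inner_self_eq_norm_sq, b.norm_eq_one] at h1
    exact le_of_sq_le_sq (by simpa using h1) (T.singularValues_nonneg _)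
  · intro k _ hk
    rw [orthonormal_iff_ite.1 b.orthonormal, if_neg hk]
    simp
  · simp

/-- On the orthogonal complement of a right singular vector for the smallest singular value, `T`
expands at least by the second smallest singular value. -/
theorem sq_singularValues_mul_norm_sq_le (hn : Module.finrank ℝ E = n) (hn2 : 2 ≤ n)
    (T : E →ₗ[ℝ] E) {c : ℝ} {v : E} (hT : ∀ x, c ^ 2 * ‖x‖ ^ 2 ≤ ‖T x‖ ^ 2) (hv : v ≠ 0)
    (hTv : T.adjoint (T v) = (c ^ 2) • v) (hc : 0 ≤ c) {x : E} (hx : inner ℝ x v = (0 : ℝ)) :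
    T.singularValues (n - 2) ^ 2 * ‖x‖ ^ 2 ≤ ‖T x‖ ^ 2 := by
  have hlast := singularValues_last_eq hn T hT hv hTv hc
  have hge : c ≤ T.singularValues (n - 2) := hlast ▸ T.singularValues_antitone (by omega)
  rcases hge.eq_or_lt with heq | hlt
  · rw [← heq]
    exact hT x
  set b := T.isSymmetric_adjoint_comp_self.eigenvectorBasis hn with hb
  set j : Fin n := ⟨n - 1, by omega⟩ with hj
  have hsv : ∀ i : Fin n, i ≠ j → T.singularValues (n - 2) ≤ T.singularValues i := fun i hi =>
    T.singularValues_antitone (by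
      have h1 := i.2
      have h2 : (i : ℕ) ≠ n - 1 := fun h => hi (Fin.ext h)
      omega)
  -- The singular value `c` is simple, so `v` is a multiple of the last basis vector.
  have horth : ∀ i, i ≠ j → inner ℝ (b i) v = (0 : ℝ) := fun i hi => by
    have h1 := T.isSymmetric_adjoint_comp_self (b i) v
    rw [LinearMap.IsSymmetric.apply_eigenvectorBasis, real_inner_smul_left, LinearMap.comp_apply,
      hTv, real_inner_smul_right, ← T.sq_singularValues_fin hn i] at h1
    simp only [RCLike.ofReal_real_eq_id, id] at h1
    have h2 : c ^ 2 < T.singularValues i ^ 2 :=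
      pow_lt_pow_left₀ (hlt.trans_le (hsv i hi)) hc two_ne_zero
    have h3 : (T.singularValues i ^ 2 - c ^ 2) * inner ℝ (b i) v = (0 : ℝ) := by linarith
    exact (mul_eq_zero.1 h3).resolve_left (sub_ne_zero.2 h2.ne')
  have hvj : inner ℝ (b j) v ≠ (0 : ℝ) := fun h0 => hv (by
    rw [← b.sum_repr' v]
    refine Finset.sum_eq_zero fun i _ => ?_
    by_cases hi : i = j
    · rw [hi, h0, zero_smul]
    · rw [horth i hi, zero_smul])
  have hxj : inner ℝ (b j) x = (0 : ℝ) := by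
    rw [← b.sum_inner_mul_inner, Finset.sum_eq_single j (fun i _ hi => by
      rw [horth i hi, mul_zero]) (by simp)] at hx
    rw [real_inner_comm]
    exact (mul_eq_zero.1 hx).resolve_right hvj
  rw [norm_sq_apply_eq_sum_singularValues hn T, ← hb, ← b.sum_sq_norm_inner_right x,
    Finset.mul_sum]
  refine Finset.sum_le_sum fun i _ => ?_
  rw [Real.norm_eq_abs, sq_abs]
  by_cases hi : i = j
  · rw [hi, hxj]
    simp
  · have := T.singularValues_nonneg (n - 2)
    gcongr
    exact hsv i hi

end SingularValues

theorem norm_toLp_sq (x : Fin d → ℝ) : ‖WithLp.toLp 2 x‖ ^ 2 = x ⬝ᵥ x := by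
  rw [EuclideanSpace.real_norm_sq_eq]
  simp [dotProduct, sq]

theorem toEuclideanLin_norm_sq (A : Matrix (Fin d) (Fin d) ℝ) (x : EuclideanSpace ℝ (Fin d)) :
    ‖Matrix.toEuclideanLin (1 - A) x‖ ^ 2 = ((A - 1) *ᵥ x.ofLp) ⬝ᵥ ((A - 1) *ᵥ x.ofLp) := by
  rw [Matrix.toLpLin_apply, norm_toLp_sq, ← neg_sub A 1, neg_mulVec, neg_dotProduct_neg]

theorem IsSingularPair.adjoint_apply {A L : Matrix (Fin d) (Fin d) ℝ} {c : ℝ} {v u : Fin d → ℝ}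
    (h : IsSingularPair A L c v u) :
    (Matrix.toEuclideanLin (1 - A)).adjoint (Matrix.toEuclideanLin (1 - A) (WithLp.toLp 2 v)) =
      (c ^ 2) • WithLp.toLp 2 v := by
  rw [← Matrix.toEuclideanLin_conjTranspose_eq_adjoint, Matrix.toLpLin_apply, Matrix.toLpLin_apply,
    conjTranspose_eq_transpose_of_trivial, ← WithLp.toLp_smul, mulVec_mulVec, ← neg_sub A 1,
    transpose_neg, neg_mul_neg, ← mulVec_mulVec, h.mulVec_right, mulVec_smul, h.mulVec_left,
    smul_smul, sq]

theorem toLp_ne_zero {v : Fin d → ℝ} (hv : v ⬝ᵥ v = 1) : WithLp.toLp 2 v ≠ 0 := by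
  intro h
  rw [← norm_toLp_sq, h] at hv
  simp at hv

theorem norm_sq_le_of_rayleigh {A : Matrix (Fin d) (Fin d) ℝ} {c : ℝ}
    (hB : ∀ x, c ^ 2 * (x ⬝ᵥ x) ≤ ((A - 1) *ᵥ x) ⬝ᵥ ((A - 1) *ᵥ x))
    (x : EuclideanSpace ℝ (Fin d)) :
    c ^ 2 * ‖x‖ ^ 2 ≤ ‖Matrix.toEuclideanLin (1 - A) x‖ ^ 2 := by
  rw [toEuclideanLin_norm_sq]
  exact (congrArg _ (norm_toLp_sq x.ofLp)).trans_le (hB x.ofLp)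

theorem IsSingularPair.sigma_one {A L : Matrix (Fin d) (Fin d) ℝ} {c : ℝ} {v u : Fin d → ℝ}
    (h : IsSingularPair A L c v u)
    (hB : ∀ x, c ^ 2 * (x ⬝ᵥ x) ≤ ((A - 1) *ᵥ x) ⬝ᵥ ((A - 1) *ᵥ x)) : sigma A 1 = c :=
  singularValues_last_eq finrank_euclideanSpace_fin _ (norm_sq_le_of_rayleigh hB)
    (toLp_ne_zero h.unit_right) h.adjoint_apply h.pos.le

theorem IsSingularPair.sigma_two_le {A L : Matrix (Fin d) (Fin d) ℝ} {c : ℝ} {v u : Fin d → ℝ}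
    (h : IsSingularPair A L c v u) (hd : 2 ≤ d)
    (hB : ∀ x, c ^ 2 * (x ⬝ᵥ x) ≤ ((A - 1) *ᵥ x) ⬝ᵥ ((A - 1) *ᵥ x)) {x : Fin d → ℝ}
    (hx : x ⬝ᵥ v = 0) :
    sigma A 2 ^ 2 * (x ⬝ᵥ x) ≤ ((A - 1) *ᵥ x) ⬝ᵥ ((A - 1) *ᵥ x) := by
  have := sq_singularValues_mul_norm_sq_le finrank_euclideanSpace_fin hd _
    (norm_sq_le_of_rayleigh hB) (toLp_ne_zero h.unit_right) h.adjoint_apply h.pos.le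
    (x := WithLp.toLp 2 x) (by
      rw [EuclideanSpace.inner_eq_star_dotProduct]
      simpa [dotProduct_comm] using hx)
  rwa [norm_toLp_sq, toEuclideanLin_norm_sq] at this

/-! ### Inverse power iteration and the rate of convergence -/

/-- Once the new matrix is positive and lies below `A`, every constraint is active, and the step
returns the matrix closest to `A` among those that fix the eigenvector. -/
theorem RightStep.exists_eq_closestFixing [Nonempty (Fin d)] {A X Y : Matrix (Fin d) (Fin d) ℝ}
    (h : RightStep A X Y) (hY : ∀ i j, 0 < Y i j) (hYA : ∀ i j, Y i j < A i j) {p : Fin d → ℝ}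
    (hp : ∀ i, 0 < p i) :
    ∃ w : Fin d → ℝ, (∀ i, 0 < w i) ∧ w ⬝ᵥ p = 1 ∧ X *ᵥ w = rho X • w ∧
      Y = closestFixing A w := by
  obtain ⟨w, hw, hwp, hXw, hs⟩ := h.exists_normalized hp
  have hww := dotProduct_pos hw hw
  obtain ⟨t, ht, htw, hcompl⟩ := hs.exists_multiplier hww hY
  have hYw : Y *ᵥ w = w := funext fun i => by
    refine sub_eq_zero.1 ((mul_eq_zero.1 (hcompl i)).resolve_left fun h0 => ?_)
    have h1 := congrFun (congrFun htw i) i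
    rw [vecMulVec_apply, h0, zero_mul, Matrix.sub_apply, sub_eq_zero] at h1
    exact (hYA i i).ne' h1
  refine ⟨w, hw, hwp, hXw, ?_⟩
  have h2 : (A - 1) *ᵥ w = (w ⬝ᵥ w) • t := by
    rw [Matrix.sub_mulVec, one_mulVec]
    nth_rw 2 [← hYw]
    rw [← Matrix.sub_mulVec, htw, vecMulVec_mulVec, op_smul_eq_smul]
  rw [closestFixing, h2, smul_vecMulVec, inv_smul_smul₀ hww.ne', ← htw, sub_sub_cancel]

/-- `Y` is the matrix closest to `A` that fixes a positive vector `w`, normalized by `w · p = 1`,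
whose squared distance from the unit vector `p` is at most `δ`. As `w - p` is orthogonal to `p`,
this distance is the tangent of the angle between `w` and `p`. -/
def FixesNear (A : Matrix (Fin d) (Fin d) ℝ) (p : Fin d → ℝ) (Y : Matrix (Fin d) (Fin d) ℝ)
    (δ : ℝ) : Prop :=
  ∃ w : Fin d → ℝ, (∀ i, 0 < w i) ∧ w ⬝ᵥ p = 1 ∧ Y = closestFixing A w ∧
    (w - p) ⬝ᵥ (w - p) ≤ δ

/-- The expansion bound passes from `A - 1` on `v⊥` to its transpose on `u⊥`: each `y ⟂ u` is
`(A - 1) x` with `x ⟂ v`, and `|y|² = x · (A - 1)ᵀ y`. -/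
theorem IsSingularPair.expansion_transpose {A L : Matrix (Fin d) (Fin d) ℝ} {c σ : ℝ}
    {v u : Fin d → ℝ} (h : IsSingularPair A L c v u)
    (hB : ∀ x, c ^ 2 * (x ⬝ᵥ x) ≤ ((A - 1) *ᵥ x) ⬝ᵥ ((A - 1) *ᵥ x))
    (hσ : ∀ x, x ⬝ᵥ v = 0 → σ ^ 2 * (x ⬝ᵥ x) ≤ ((A - 1) *ᵥ x) ⬝ᵥ ((A - 1) *ᵥ x))
    {y : Fin d → ℝ} (hy : y ⬝ᵥ u = 0) :
    σ ^ 2 * (y ⬝ᵥ y) ≤ ((A - 1)ᵀ *ᵥ y) ⬝ᵥ ((A - 1)ᵀ *ᵥ y) := by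
  rcases (dotProduct_self_nonneg' y).eq_or_lt with h0 | hpos
  · rw [← h0, mul_zero]
    exact dotProduct_self_nonneg' _
  have hdet : IsUnit (A - 1).det := by
    refine isUnit_iff_ne_zero.2 fun hd => ?_
    obtain ⟨x, hx, hx0⟩ := Matrix.exists_mulVec_eq_zero_iff.2 hd
    have h1 := hB x
    rw [hx0, dotProduct_zero] at h1
    exact absurd h1 (not_le.2 (mul_pos (pow_pos h.pos 2) (dotProduct_self_pos_of_ne_zero hx)))
  obtain ⟨x, rfl⟩ : ∃ x, (A - 1) *ᵥ x = y :=
    ⟨(A - 1)⁻¹ *ᵥ y, by rw [mulVec_mulVec, mul_nonsing_inv _ hdet, one_mulVec]⟩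
  have hmove : ∀ z, ((A - 1) *ᵥ x) ⬝ᵥ z = x ⬝ᵥ ((A - 1)ᵀ *ᵥ z) := fun z => by
    rw [mulVec_transpose, dotProduct_comm, dotProduct_mulVec, dotProduct_comm]
  have hxv : x ⬝ᵥ v = 0 := by
    rw [hmove, h.mulVec_left, dotProduct_smul, smul_eq_mul] at hy
    exact (mul_eq_zero.1 hy).resolve_left h.pos.ne'
  have h1 := hσ x hxv
  set y := (A - 1) *ᵥ x with hydef
  set z := (A - 1)ᵀ *ᵥ y with hz
  have h2 : (y ⬝ᵥ y) ^ 2 ≤ (x ⬝ᵥ x) * (z ⬝ᵥ z) := by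
    rw [hydef, hmove, ← hydef, ← hz]
    have := Finset.sum_mul_sq_le_sq_mul_sq Finset.univ x z
    simpa only [dotProduct, sq] using this
  refine le_of_mul_le_mul_right ?_ hpos
  calc σ ^ 2 * (y ⬝ᵥ y) * (y ⬝ᵥ y) = σ ^ 2 * (y ⬝ᵥ y) ^ 2 := by ring
    _ ≤ σ ^ 2 * ((x ⬝ᵥ x) * (z ⬝ᵥ z)) := mul_le_mul_of_nonneg_left h2 (sq_nonneg _)
    _ = σ ^ 2 * (x ⬝ᵥ x) * (z ⬝ᵥ z) := by ring
    _ ≤ (y ⬝ᵥ y) * (z ⬝ᵥ z) := mul_le_mul_of_nonneg_right h1 (dotProduct_self_nonneg' _)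
    _ = _ := mul_comm _ _

/-- One step of the inverse power iteration: the next eigenvector `w'` satisfies
`(A - 1)ᵀ w' = c w`, so the component orthogonal to the singular vector shrinks by `c / σ`. -/
theorem FixesNear.step [Nonempty (Fin d)] {A L Y Z : Matrix (Fin d) (Fin d) ℝ} {c σ δ : ℝ}
    {v u : Fin d → ℝ} (h : IsSingularPair A L c v u) (hσ0 : 0 < σ)
    (hσ : ∀ y, y ⬝ᵥ u = 0 → σ ^ 2 * (y ⬝ᵥ y) ≤ ((A - 1)ᵀ *ᵥ y) ⬝ᵥ ((A - 1)ᵀ *ᵥ y))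
    (hY : FixesNear A v Y δ) (hYpos : ∀ i j, 0 < Y i j) (hstep : RightStep Aᵀ Yᵀ Z)
    (hZ : ∀ i j, 0 < Z i j) (hZA : ∀ i j, Z i j < Aᵀ i j) :
    FixesNear Aᵀ u Z ((c / σ) ^ 2 * δ) := by
  obtain ⟨w, hw, hwv, hYeq, hδ⟩ := hY
  obtain ⟨w', hw', hwu, hYw', hZeq⟩ := hstep.exists_eq_closestFixing hZ hZA h.pos_left
  refine ⟨w', hw', hwu, hZeq, ?_⟩
  have hww := dotProduct_pos hw hw
  have hYw : Y *ᵥ w = w := by rw [hYeq, closestFixing_mulVec A hww.ne']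
  have hρ : rho Y = 1 := by
    refine rho_eq_one (fun i j => (hYpos i j).le) hw ?_ hYw
    intro h0
    rw [h0, dotProduct_zero] at hww
    exact lt_irrefl _ hww
  rw [rho_transpose, hρ, one_smul] at hYw'
  obtain ⟨α, hα⟩ : ∃ α : ℝ, (A - 1)ᵀ *ᵥ w' = α • w := by
    have h1 : (A - 1)ᵀ *ᵥ w' = (A - Y)ᵀ *ᵥ w' := by
      rw [transpose_sub, transpose_sub, Matrix.sub_mulVec, Matrix.sub_mulVec, hYw', transpose_one,
        one_mulVec]
    rw [h1, hYeq, closestFixing, sub_sub_cancel, transpose_smul, transpose_vecMulVec, smul_mulVec,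
      vecMulVec_mulVec, op_smul_eq_smul, smul_smul]
    exact ⟨_, rfl⟩
  have hαc : α = c := by
    have h1 : ((A - 1)ᵀ *ᵥ w') ⬝ᵥ v = c := by
      rw [mulVec_transpose, ← dotProduct_mulVec, h.mulVec_right, dotProduct_smul, hwu, smul_eq_mul,
        mul_one]
    rwa [hα, smul_dotProduct, hwv, smul_eq_mul, mul_one] at h1
  have he : (A - 1)ᵀ *ᵥ (w' - u) = c • (w - v) := by
    rw [mulVec_sub, hα, hαc, h.mulVec_left, smul_sub]
  have h1 := hσ (w' - u) (by rw [sub_dotProduct, hwu, h.unit_left, sub_self])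
  rw [he, smul_dotProduct, dotProduct_smul, smul_eq_mul, smul_eq_mul, ← mul_assoc, ← sq] at h1
  have h2 := h1.trans (mul_le_mul_of_nonneg_left hδ (sq_nonneg c))
  rw [div_pow, div_mul_eq_mul_div, le_div_iff₀ (pow_pos hσ0 2)]
  linarith

theorem FixesNear.norm_sub_sq_le {A L Y : Matrix (Fin d) (Fin d) ℝ} {c δ : ℝ}
    {v u : Fin d → ℝ} (h : IsSingularPair A L c v u) (hY : FixesNear A v Y δ) :
    ‖Y - L‖ ^ 2 ≤ 2 * ‖A - 1‖ ^ 2 * δ := by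
  obtain ⟨w, hw, hwv, rfl, hδ⟩ := hY
  set s := w ⬝ᵥ w with hs
  have hse : s = 1 + (w - v) ⬝ᵥ (w - v) := by
    rw [sub_dotProduct, dotProduct_sub, dotProduct_sub, dotProduct_comm v w, hwv, h.unit_right]
    ring
  have hs1 : 1 ≤ s := by rw [hse]; linarith [dotProduct_self_nonneg' (w - v)]
  have hs0 : 0 < s := one_pos.trans_le hs1
  set Q := s⁻¹ • vecMulVec w w - vecMulVec v v with hQ
  have hfac : closestFixing A w - L = -((A - 1) * Q) := by
    rw [← h.closestFixing_eq, closestFixing, closestFixing, h.unit_right, inv_one, one_smul, hQ,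
      mul_sub, Matrix.mul_smul, mul_vecMulVec, mul_vecMulVec]
    abel
  have hQn : ‖Q‖ ^ 2 = 2 * (1 - s⁻¹) := by
    have hexp : ‖Q‖ ^ 2 = s⁻¹ ^ 2 * ‖vecMulVec w w‖ ^ 2 +
        (-(2 * s⁻¹) * ∑ i, ∑ j, vecMulVec w w i j * vecMulVec v v i j + ‖vecMulVec v v‖ ^ 2) := by
      simp only [frobenius_norm_sq, Finset.mul_sum, ← Finset.sum_add_distrib]
      refine Finset.sum_congr rfl fun i _ => Finset.sum_congr rfl fun j _ => ?_
      simp only [hQ, Matrix.sub_apply, Matrix.smul_apply, smul_eq_mul]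
      ring
    rw [hexp, sum_mul_vecMulVec, frobenius_norm_sq_vecMulVec, frobenius_norm_sq_vecMulVec,
      vecMulVec_mulVec, op_smul_eq_smul, hwv, one_smul, dotProduct_comm v w, hwv, h.unit_right,
      ← hs]
    field_simp
    ring
  have hQle : ‖Q‖ ^ 2 ≤ 2 * δ := by
    rw [hQn]
    have h1 : 1 - s⁻¹ ≤ s - 1 := by
      have : 1 - s⁻¹ = (s - 1) / s := by field_simp
      rw [this]
      exact div_le_self (by linarith) hs1
    linarith
  calc ‖closestFixing A w - L‖ ^ 2 = ‖(A - 1) * Q‖ ^ 2 := by rw [hfac, norm_neg]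
    _ ≤ (‖A - 1‖ * ‖Q‖) ^ 2 := by
      gcongr
      exact Matrix.frobenius_norm_mul _ _
    _ = ‖A - 1‖ ^ 2 * ‖Q‖ ^ 2 := mul_pow _ _ _
    _ ≤ ‖A - 1‖ ^ 2 * (2 * δ) := by gcongr
    _ = _ := by ring

/-- A geometric bound from some index on extends to all indices. -/
theorem exists_forall_le_mul_pow {a : ℕ → ℝ} (ha : ∀ n, 0 ≤ a n) {C r : ℝ} (hC : 0 ≤ C)
    (hr : 0 < r) {N : ℕ} (h : ∀ j, a (N + j) ≤ C * r ^ j) : ∃ C', ∀ n, a n ≤ C' * r ^ n := by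
  have hterm : ∀ i ∈ Finset.range N, 0 ≤ a i / r ^ i := fun i _ =>
    div_nonneg (ha i) (pow_pos hr i).le
  refine ⟨C / r ^ N + ∑ i ∈ Finset.range N, a i / r ^ i, fun n => ?_⟩
  have hrn := pow_pos hr n
  rw [← div_le_iff₀ hrn]
  rcases lt_or_ge n N with hn | hn
  · exact (Finset.single_le_sum hterm (Finset.mem_range.2 hn)).trans
      (le_add_of_nonneg_left (div_nonneg hC (pow_pos hr N).le))
  · obtain ⟨j, rfl⟩ := Nat.exists_eq_add_of_le hn
    refine le_trans ?_ (le_add_of_nonneg_right (Finset.sum_nonneg hterm))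
    rw [div_le_div_iff₀ hrn (pow_pos hr N), pow_add]
    calc a (N + j) * r ^ N ≤ C * r ^ j * r ^ N :=
          mul_le_mul_of_nonneg_right (h j) (pow_pos hr N).le
      _ = _ := by ring

theorem exists_rate [Nonempty (Fin d)] {A L : Matrix (Fin d) (Fin d) ℝ} {c σ : ℝ}
    {v u : Fin d → ℝ} (h : IsSingularPair A L c v u) (hσ0 : 0 < σ)
    (hB : ∀ x, c ^ 2 * (x ⬝ᵥ x) ≤ ((A - 1) *ᵥ x) ⬝ᵥ ((A - 1) *ᵥ x))
    (hσ : ∀ x, x ⬝ᵥ v = 0 → σ ^ 2 * (x ⬝ᵥ x) ≤ ((A - 1) *ᵥ x) ⬝ᵥ ((A - 1) *ᵥ x))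
    {X : ℕ → Matrix (Fin d) (Fin d) ℝ} (hX : IsRun A X) (hconv : ConvergesTo X L)
    (hL : ∀ i j, 0 < L i j) : ∃ C : ℝ, ∀ n, ‖X n - L‖ ≤ C * (c / σ) ^ n := by
  have hent := tendsto_apply_of_tendsto_norm_sub hconv
  have hLA : ∀ i j, L i j < A i j := fun i j => by
    have h1 := congrFun (congrFun h.sub_eq i) j
    rw [Matrix.sub_apply, Matrix.smul_apply, vecMulVec_apply, smul_eq_mul] at h1
    have h2 := mul_pos h.pos (mul_pos (h.pos_left i) (h.pos_right j))
    linarith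
  have hev : ∀ᶠ n in atTop, ∀ i j, 0 < X n i j ∧ X n i j < A i j :=
    eventually_all.2 fun i => eventually_all.2 fun j =>
      ((hent i j).eventually (lt_mem_nhds (hL i j))).and
        ((hent i j).eventually (gt_mem_nhds (hLA i j)))
  obtain ⟨K, hK⟩ := eventually_atTop.1 hev
  have hσT : ∀ y, y ⬝ᵥ u = 0 →
      σ ^ 2 * (y ⬝ᵥ y) ≤ ((A - 1)ᵀ *ᵥ y) ⬝ᵥ ((A - 1)ᵀ *ᵥ y) := fun y hy =>
    h.expansion_transpose hB hσ hy
  obtain ⟨w, hw, hwv, -, hXw⟩ := ((hX.2 (2 * K)).1 (even_two_mul K)).exists_eq_closestFixing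
    (fun i j => (hK (2 * K + 1) (by omega) i j).1) (fun i j => (hK (2 * K + 1) (by omega) i j).2)
    h.pos_right
  set δ := (w - v) ⬝ᵥ (w - v) with hδ
  set q := (c / σ) ^ 2 with hq
  have hodd : ∀ m, FixesNear A v (X (2 * K + 1 + 2 * m)) (q ^ (2 * m) * δ) →
      FixesNear Aᵀ u (X (2 * K + 1 + 2 * m + 1))ᵀ (q ^ (2 * m + 1) * δ) := fun m hm => by
    rw [pow_succ', mul_assoc]
    exact hm.step h hσ0 hσT (fun i j => (hK _ (by omega) i j).1)
      ((hX.2 (2 * K + 1 + 2 * m)).2 ⟨K + m, by ring⟩).transpose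
      (fun i j => (hK _ (by omega) j i).1) (fun i j => (hK _ (by omega) j i).2)
  have heven : ∀ m, FixesNear A v (X (2 * K + 1 + 2 * m)) (q ^ (2 * m) * δ) := by
    intro m
    induction m with
    | zero => exact ⟨w, hw, hwv, hXw, by simp [hδ]⟩
    | succ m ih =>
      have h1 := hodd m ih
      have h2 : RightStep A (X (2 * K + 1 + 2 * m + 1)) (X (2 * K + 1 + 2 * (m + 1))) :=
        (hX.2 (2 * K + 1 + 2 * m + 1)).1 ⟨K + m + 1, by ring⟩
      have h3 := h1.step h.transpose hσ0 (Z := X (2 * K + 1 + 2 * (m + 1)))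
        (by simpa using hσ) (fun i j => (hK _ (by omega) j i).1) (by simpa using h2)
        (fun i j => (hK _ (by omega) i j).1)
        (fun i j => by simpa using (hK _ (by omega) i j).2)
      rw [transpose_transpose, ← mul_assoc, ← pow_succ'] at h3
      exact h3
  have hsq : ∀ j, ‖X (2 * K + 1 + j) - L‖ ^ 2 ≤ 2 * ‖A - 1‖ ^ 2 * (q ^ j * δ) := by
    intro j
    rcases Nat.even_or_odd' j with ⟨m, rfl | rfl⟩
    · exact (heven m).norm_sub_sq_le h
    · have h1 := (hodd m (heven m)).norm_sub_sq_le h.transpose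
      rw [← transpose_sub, Matrix.frobenius_norm_transpose, ← transpose_one, ← transpose_sub,
        Matrix.frobenius_norm_transpose] at h1
      exact h1
  have hδ0 : 0 ≤ δ := dotProduct_self_nonneg' _
  refine exists_forall_le_mul_pow (fun n => norm_nonneg _) (Real.sqrt_nonneg (2 * ‖A - 1‖ ^ 2 * δ))
    (div_pos h.pos hσ0) (N := 2 * K + 1) fun j => ?_
  refine le_of_sq_le_sq ((hsq j).trans_eq ?_)
    (mul_nonneg (Real.sqrt_nonneg _) (pow_nonneg (div_pos h.pos hσ0).le j))
  rw [mul_pow, Real.sq_sqrt (by positivity), hq, ← pow_mul, ← pow_mul]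
  ring

end ClosestStable

theorem theorem7 (d : ℕ) (A : Matrix (Fin d) (Fin d) ℝ)
    (hA : ClosestStable.Nonneg A) (hρ : 1 < ClosestStable.rho A)
    (X : ℕ → Matrix (Fin d) (Fin d) ℝ) (L : Matrix (Fin d) (Fin d) ℝ)
    (hX : ClosestStable.StablyConverges A X L) (hL : ∀ i j, 0 < L i j) :
    ClosestStable.IsClosestStable A L ∧
      ClosestStable.IsExplicitMatrix A L ∧
      (2 ≤ d → ∃ C : ℝ, ∀ n : ℕ,
        ‖X n - L‖ ≤ C * (ClosestStable.sigma A 1 / ClosestStable.sigma A 2) ^ n) := by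
  have hne := ClosestStable.nonempty_of_one_lt_rho hρ
  obtain ⟨c, v, u, h⟩ := ClosestStable.exists_isSingularPair hρ hX.1 hX.2.1 hL
  have hB := h.le_rayleigh hX hL
  have hnorm : ‖L - A‖ = c :=
    (pow_left_inj₀ (norm_nonneg _) h.pos.le two_ne_zero).1 h.norm_sub
  refine ⟨⟨fun i j => (hL i j).le, ?_, fun Y hY hYρ => ?_⟩, h.isExplicitMatrix hL hB, fun hd => ?_⟩
  · refine ClosestStable.rho_le_of_mulVec_le (fun i j => (hL i j).le) h.pos_right zero_le_one
      fun i => ?_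
    rw [← h.closestFixing_eq, ClosestStable.closestFixing_mulVec A
      (by rw [h.unit_right]; exact one_ne_zero), one_mul]
  · rw [hnorm]
    exact ClosestStable.le_norm_sub_of_rho_le_one hA hρ hB hY hYρ
  · have h1 := h.sigma_one hB
    have hle : ClosestStable.sigma A 1 ≤ ClosestStable.sigma A 2 :=
      LinearMap.singularValues_antitone _ (by omega)
    rw [h1] at hle ⊢
    exact ClosestStable.exists_rate h (h.pos.trans_le hle) hB
      (fun x hx => h.sigma_two_le hd hB hx) hX.1 hX.2.1 hL
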